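/- Consider the complex Gaussian MIMO relay channel \[ \mathbf Y_2 = G_{21}\mathbf X_1+\mathbf Z_2,\qquad \mathbf Y_3 = G_{31}\mathbf X_1+G_{32}\mathbf X_2+\mathbf Z_3, \] with channel gain matrices $G_{21}\in\mathbb C^{r_2\times t_1}$, $G_{31}\in\mathbb C^{r_3\times t_1}$, $G_{32}\in\mathbb C^{r_3\times t_2}$, independent noise vectors $\mathbf Z_2\sim\mathrm{CN}(0,I_{r_2})$, $\mathbf Z_3\sim\mathrm{CN}(0,I_{r_3})$ that are independent of the inputs, and average power constraint $P\ge 0$ at both the sender and the relay. Let \[ R_{\mathrm{CS}}=\sup_{F(\mathbf x_1,\mathbf x_2)}\min\bigl\{I(\mathbf X_1,\mathbf X_2;\mathbf Y_3),\ I(\mathbf X_1;\mathbf Y_2,\mathbf Y_3\mid\mathbf X_2)\bigr\} \] be the cutset bound and \[ R_{\mathrm{PDF}}=\sup_{F(\mathbf u,\mathbf x_1,\mathbf x_2)}\min\bigl\{I(\mathbf X_1,\mathbf X_2;\mathbf Y_3),\ I(\mathbf U;\mathbf Y_2\mid\mathbf X_2)+I(\mathbf X_1;\mathbf Y_3\mid\mathbf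 X_2,\mathbf U)\bigr\} \] the partial decode--forward bound, where the suprema are over all joint distributions with $\mathbb E(\mathbf X_j^{\mathsf H}\mathbf X_j)\le P$, $j=1,2$, where $\mathbf U$ is a complex random vector of arbitrary dimension such that $(\mathbf U,\mathbf X_1,\mathbf X_2)$ is independent of the noise, and where mutual information is measured in bits. Let $C$ be the capacity of the channel, the supremum of the rates $R$ for which there are $(2^{nR},n)$ codes (with encoder $\mathbf x_1^n(m)$, relay encoders $\mathbf x_{2i}(\mathbf y_2^{i-1})$ and decoder $\hat m(\mathbf y_3^n)$) with $\sum_{i=1}^n\mathbb E(\mathbf X_{ji}^{\mathsf H}\mathbf X_{ji})\le nP$, $j=1,2$, whose average probability of error tends to $0$ as $n\to\infty$. Then for every $t_1,t_2,r_2,r_3$, every $G_{21},G_{31},G_{32}$ and every $P\ge0$, both $R_{\mathrm{CS}}$ and $R_{\mathrm{PDF}}$ are finite and \[ R_{\mathrm{CS}}\le 2\,R_{\mathrm{PDF}}, \] that is, $R_{\mathrm{CS}}/R_{\mathrm{PDF}}\le 2$ whenever $R_{\mathrm{PDF}}>0$, and $R_{\mathrm{CS}}=0$ if $R_{\mathrm{PDF}}=0$.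 Partial decode--forward always achieves at least half the capacity: $C\le 2\,R_{\mathrm{PDF}}$. -/

import Mathlib

open MeasureTheory ProbabilityTheory
open scoped ENNReal NNReal Matrix

noncomputable section

namespace MIMORelay

/-! ### Mutual information, in bits -/

section Information

variable {Ω α β γ : Type*} [MeasurableSpace Ω] [MeasurableSpace α] [MeasurableSpace β]
  [MeasurableSpace γ]

/-- Mutual information `I(X; Y) = D(P_{X,Y} ‖ P_X × P_Y)`, in bits. -/
def mutualInfo (μ : Measure Ω) (X : Ω → α) (Y : Ω → β) : ℝ≥0∞ :=
  InformationTheory.klDiv (μ.map fun ω => (X ω, Y ω)) ((μ.map X).prod (μ.map Y))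
    / ENNReal.ofReal (Real.log 2)

/-- Conditional mutual information
`I(X; Y | Z) = D(P_{Z,X,Y} ‖ P_Z ⊗ (P_{X|Z} × P_{Y|Z}))`, in bits. -/
def condMutualInfo [StandardBorelSpace α] [Nonempty α] [StandardBorelSpace β] [Nonempty β]
    (μ : Measure Ω) [IsFiniteMeasure μ] (X : Ω → α) (Y : Ω → β) (Z : Ω → γ) : ℝ≥0∞ :=
  InformationTheory.klDiv (μ.map fun ω => (Z ω, X ω, Y ω))
      (μ.map Z ⊗ₘ (condDistrib X Z μ ×ₖ condDistrib Y Z μ))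
    / ENNReal.ofReal (Real.log 2)

end Information

/-! ### The channel -/

/-- The vector space `ℂⁿ`, with its Borel σ-algebra. -/
abbrev CVec (n : ℕ) : Type := Fin n → ℂ

/-- The squared Euclidean norm `xᴴ x`, as an extended nonnegative real. -/
def energy {n : ℕ} (x : CVec n) : ℝ≥0∞ := ∑ k, ‖x k‖ₑ ^ 2

/-- The circularly symmetric complex Gaussian law `CN(0, 1)` on `ℂ`: the real and imaginary parts
are independent and real Gaussian with variance `1/2`. -/
def stdComplexGaussian : Measure ℂ :=
  ((gaussianReal 0 (1 / 2)).prod (gaussianReal 0 (1 / 2))).map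
    Complex.measurableEquivRealProd.symm

instance : IsProbabilityMeasure stdComplexGaussian :=
  Measure.isProbabilityMeasure_map Complex.measurableEquivRealProd.symm.measurable.aemeasurable

/-- The law `CN(0, I_r)` on `ℂʳ`: independent `CN(0, 1)` components. -/
def noise (r : ℕ) : Measure (CVec r) := Measure.pi fun _ => stdComplexGaussian

instance (r : ℕ) : IsProbabilityMeasure (noise r) :=
  inferInstanceAs (IsProbabilityMeasure (Measure.pi fun _ : Fin r => stdComplexGaussian))

/-- The channel gain matrices of a MIMO relay channel (sender 1, relay 2, receiver 3). -/
structure Channel (t₁ t₂ r₂ r₃ : ℕ) where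
  G₂₁ : Matrix (Fin r₂) (Fin t₁) ℂ
  G₃₁ : Matrix (Fin r₃) (Fin t₁) ℂ
  G₃₂ : Matrix (Fin r₃) (Fin t₂) ℂ

variable {t₁ t₂ r₂ r₃ : ℕ}

/-- The channel output at the relay, `Y₂ = G₂₁ X₁ + Z₂`. -/
def Channel.out₂ (G : Channel t₁ t₂ r₂ r₃) (x₁ : CVec t₁) (z₂ : CVec r₂) : CVec r₂ :=
  G.G₂₁ *ᵥ x₁ + z₂

/-- The channel output at the receiver, `Y₃ = G₃₁ X₁ + G₃₂ X₂ + Z₃`. -/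
def Channel.out₃ (G : Channel t₁ t₂ r₂ r₃) (x₁ : CVec t₁) (x₂ : CVec t₂) (z₃ : CVec r₃) :
    CVec r₃ :=
  G.G₃₁ *ᵥ x₁ + G.G₃₂ *ᵥ x₂ + z₃

/-! ### The cutset bound and the partial decode–forward bound -/

/-- `min {I(X₁, X₂; Y₃), I(X₁; Y₂, Y₃ | X₂)}` for the input distribution `(X₁, X₂) ∼ ν`, the
noise `(Z₂, Z₃) ∼ CN(0, I) × CN(0, I)` being independent of the input. -/
def Channel.cutsetRate (G : Channel t₁ t₂ r₂ r₃) (ν : ProbabilityMeasure (CVec t₁ × CVec t₂)) :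
    ℝ≥0∞ :=
  let μ : Measure ((CVec t₁ × CVec t₂) × CVec r₂ × CVec r₃) :=
    (ν : Measure (CVec t₁ × CVec t₂)).prod ((noise r₂).prod (noise r₃))
  let X₁ : (CVec t₁ × CVec t₂) × CVec r₂ × CVec r₃ → CVec t₁ := fun ω => ω.1.1
  let X₂ : (CVec t₁ × CVec t₂) × CVec r₂ × CVec r₃ → CVec t₂ := fun ω => ω.1.2
  let Y₂ : (CVec t₁ × CVec t₂) × CVec r₂ × CVec r₃ → CVec r₂ := fun ω => G.out₂ (X₁ ω) ω.2.1
  let Y₃ : (CVec t₁ × CVec t₂) × CVec r₂ × CVec r₃ → CVec r₃ :=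
    fun ω => G.out₃ (X₁ ω) (X₂ ω) ω.2.2
  min (mutualInfo μ (fun ω => (X₁ ω, X₂ ω)) Y₃)
    (condMutualInfo μ X₁ (fun ω => (Y₂ ω, Y₃ ω)) X₂)

/-- The cutset bound `R_CS`: the supremum of `cutsetRate` over all input distributions with
`E(X₁ᴴ X₁) ≤ P` and `E(X₂ᴴ X₂) ≤ P`. -/
def Channel.RCS (G : Channel t₁ t₂ r₂ r₃) (P : ℝ≥0) : ℝ≥0∞ :=
  ⨆ (ν : ProbabilityMeasure (CVec t₁ × CVec t₂))
    (_ : ∫⁻ x, energy x.1 ∂(ν : Measure (CVec t₁ × CVec t₂)) ≤ P)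
    (_ : ∫⁻ x, energy x.2 ∂(ν : Measure (CVec t₁ × CVec t₂)) ≤ P), G.cutsetRate ν

/-- `min {I(X₁, X₂; Y₃), I(U; Y₂ | X₂) + I(X₁; Y₃ | X₂, U)}` for `(U, X₁, X₂) ∼ ν`, the noise
being independent of `(U, X₁, X₂)`. -/
def Channel.pdfRate (G : Channel t₁ t₂ r₂ r₃) {k : ℕ}
    (ν : ProbabilityMeasure (CVec k × CVec t₁ × CVec t₂)) : ℝ≥0∞ :=
  let μ : Measure ((CVec k × CVec t₁ × CVec t₂) × CVec r₂ × CVec r₃) :=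
    (ν : Measure (CVec k × CVec t₁ × CVec t₂)).prod ((noise r₂).prod (noise r₃))
  let U : (CVec k × CVec t₁ × CVec t₂) × CVec r₂ × CVec r₃ → CVec k := fun ω => ω.1.1
  let X₁ : (CVec k × CVec t₁ × CVec t₂) × CVec r₂ × CVec r₃ → CVec t₁ := fun ω => ω.1.2.1
  let X₂ : (CVec k × CVec t₁ × CVec t₂) × CVec r₂ × CVec r₃ → CVec t₂ := fun ω => ω.1.2.2
  let Y₂ : (CVec k × CVec t₁ × CVec t₂) × CVec r₂ × CVec r₃ → CVec r₂ :=
    fun ω => G.out₂ (X₁ ω) ω.2.1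
  let Y₃ : (CVec k × CVec t₁ × CVec t₂) × CVec r₂ × CVec r₃ → CVec r₃ :=
    fun ω => G.out₃ (X₁ ω) (X₂ ω) ω.2.2
  min (mutualInfo μ (fun ω => (X₁ ω, X₂ ω)) Y₃)
    (condMutualInfo μ U Y₂ X₂ + condMutualInfo μ X₁ Y₃ (fun ω => (X₂ ω, U ω)))

/-- The partial decode–forward bound `R_PDF`: the supremum of `pdfRate` over all distributions of
`(U, X₁, X₂)`, with `U` a complex random vector of any dimension, such that `E(X₁ᴴ X₁) ≤ P` and
`E(X₂ᴴ X₂) ≤ P`. -/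
def Channel.RPDF (G : Channel t₁ t₂ r₂ r₃) (P : ℝ≥0) : ℝ≥0∞ :=
  ⨆ (k : ℕ) (ν : ProbabilityMeasure (CVec k × CVec t₁ × CVec t₂))
    (_ : ∫⁻ x, energy x.2.1 ∂(ν : Measure (CVec k × CVec t₁ × CVec t₂)) ≤ P)
    (_ : ∫⁻ x, energy x.2.2 ∂(ν : Measure (CVec k × CVec t₁ × CVec t₂)) ≤ P), G.pdfRate ν

/-! ### Codes and capacity -/

/-- A code with `M` messages and block length `n` for the relay channel: an encoder `x₁ⁿ(m)`,
relay encoders `x₂ᵢ(y₂^{i-1})`, and a decoder `m̂(y₃ⁿ)`. -/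
structure Code (t₁ t₂ r₂ r₃ M n : ℕ) where
  enc : Fin M → Fin n → CVec t₁
  relay : (i : Fin n) → (Fin (i : ℕ) → CVec r₂) → CVec t₂
  dec : (Fin n → CVec r₃) → Fin M
  measurable_relay : ∀ i, Measurable (relay i)
  measurable_dec : Measurable dec

namespace Code

variable {M n : ℕ}

/-- The message together with the noise sequences `z₂ⁿ` and `z₃ⁿ`. -/
abbrev Sample (r₂ r₃ M n : ℕ) : Type := Fin M × (Fin n → CVec r₂) × (Fin n → CVec r₃)

/-- The message is uniform, the noise is i.i.d. over time, and all three are independent. -/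
def law (r₂ r₃ M n : ℕ) : Measure (Sample r₂ r₃ M n) :=
  (uniformOn (Set.univ : Set (Fin M))).prod
    ((Measure.pi fun _ : Fin n => noise r₂).prod (Measure.pi fun _ : Fin n => noise r₃))

/-- The symbol that the sender transmits at time `i`. -/
def x₁ (c : Code t₁ t₂ r₂ r₃ M n) (i : Fin n) (ω : Sample r₂ r₃ M n) : CVec t₁ := c.enc ω.1 i

/-- The symbol that the relay receives at time `i`. -/
def y₂ (c : Code t₁ t₂ r₂ r₃ M n) (G : Channel t₁ t₂ r₂ r₃) (i : Fin n)
    (ω : Sample r₂ r₃ M n) : CVec r₂ :=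
  G.out₂ (c.x₁ i ω) (ω.2.1 i)

/-- The symbol that the relay transmits at time `i`, a function of what it received before. -/
def x₂ (c : Code t₁ t₂ r₂ r₃ M n) (G : Channel t₁ t₂ r₂ r₃) (i : Fin n)
    (ω : Sample r₂ r₃ M n) : CVec t₂ :=
  c.relay i fun j => c.y₂ G (Fin.castLE i.isLt.le j) ω

/-- The symbol that the receiver receives at time `i`. -/
def y₃ (c : Code t₁ t₂ r₂ r₃ M n) (G : Channel t₁ t₂ r₂ r₃) (i : Fin n)
    (ω : Sample r₂ r₃ M n) : CVec r₃ :=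
  G.out₃ (c.x₁ i ω) (c.x₂ G i ω) (ω.2.2 i)

/-- The average power constraint `P` at the sender and at the relay:
`∑ᵢ E(X_{ji}ᴴ X_{ji}) ≤ n P` for `j = 1, 2`. -/
def PowerConstraint (c : Code t₁ t₂ r₂ r₃ M n) (G : Channel t₁ t₂ r₂ r₃) (P : ℝ≥0) : Prop :=
  ∑ i, ∫⁻ ω, energy (c.x₁ i ω) ∂(law r₂ r₃ M n) ≤ n * P ∧
    ∑ i, ∫⁻ ω, energy (c.x₂ G i ω) ∂(law r₂ r₃ M n) ≤ n * P

/-- The average probability of error `P(M̂ ≠ M)`. -/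
def errorProb (c : Code t₁ t₂ r₂ r₃ M n) (G : Channel t₁ t₂ r₂ r₃) : ℝ≥0∞ :=
  law r₂ r₃ M n {ω | c.dec (fun i => c.y₃ G i ω) ≠ ω.1}

end Code

/-- The rate `R` (in bits) is achievable: some sequence of `(2^{nR}, n)` codes that satisfy the
power constraint has average probability of error tending to `0`. -/
def Channel.Achievable (G : Channel t₁ t₂ r₂ r₃) (P R : ℝ≥0) : Prop :=
  ∃ c : (n : ℕ) → Code t₁ t₂ r₂ r₃ ⌈(2 : ℝ) ^ ((n : ℝ) * (R : ℝ))⌉₊ n,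
    (∀ n, (c n).PowerConstraint G P) ∧
      Filter.Tendsto (fun n => (c n).errorProb G) Filter.atTop (nhds 0)

/-- The capacity (in bits per transmission): the supremum of all achievable rates. -/
def Channel.capacity (G : Channel t₁ t₂ r₂ r₃) (P : ℝ≥0) : ℝ≥0∞ :=
  ⨆ (R : ℝ≥0) (_ : G.Achievable P R), (R : ℝ≥0∞)

end MIMORelay

end

/-! Factor two. Fix an admissible input law and let `a` = I(X₁,X₂;Y₃). The two noises are
independent, so Y₂ and Y₃ are conditionally independent given the inputs, and I(X₁;Y₂,Y₃|X₂) ≤ b + c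
with b = I(X₁;Y₂|X₂) and c = I(X₁;Y₃|X₂) (`broadcastInfo_le_add`). Partial decode–forward attains at
least min(a, b) with U = X₁ and at least min(a, c) with U constant, and min(a, b + c) ≤ min(a, b) +
min(a, c). No optimal input or Gaussian maximisation is needed.

Mutual informations are handled as averaged divergences from the channel law to a reference law Q.
Any Q gives an upper bound, and the true output law gives equality (`mutualInfo_le_lintegral`,
`condMutualInfo_le_lintegral`). With pure noise as the reference, the divergence is the energy of
the received signal, so the power constraint gives finiteness.

The converse C ≤ R_CS is a change of measure. Keep the encoders but replace the channel by some T
under which the message is independent of the receiver's observations; a decoder is then right with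
probability 1/M. A variational form of Fano's inequality bounds the true success probability through
the divergence of the two laws, which by the chain rule is at most a sum over time of single-letter
divergences (`klDiv_outputLaw_altLaw_le`). Two choices of T, made with the output laws of the
time-averaged input, turn this sum into n times either mutual information in the cutset bound. -/

noncomputable section

namespace InformationTheory

/-! ### Kullback–Leibler divergence: kernels, products and a Fano inequality. -/

section Tools

variable {α β γ : Type*} [MeasurableSpace α] [MeasurableSpace β] [MeasurableSpace γ]

lemma klDiv_map_measurableEquiv (μ ν : Measure α) [IsFiniteMeasure μ] [IsFiniteMeasure ν]
    (e : α ≃ᵐ β) : klDiv (μ.map e) (ν.map e) = klDiv μ ν := by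
  refine le_antisymm (klDiv_map_le μ ν e.measurable) ?_
  have := klDiv_map_le (μ.map e) (ν.map e) e.symm.measurable
  simpa [Measure.map_map e.symm.measurable e.measurable] using this

lemma measurable_lintegral_klFun [MeasurableSpace.CountableOrCountablyGenerated α β]
    (κ η : Kernel α β) [IsFiniteKernel κ] [IsFiniteKernel η] :
    Measurable fun a =>
      ∫⁻ b, ENNReal.ofReal (klFun (κ.rnDeriv η a b).toReal) ∂η a := by
  refine Measurable.lintegral_kernel_prod_right' (κ := η)
    (f := fun p : α × β => ENNReal.ofReal (klFun (κ.rnDeriv η p.1 p.2).toReal)) ?_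
  exact (measurable_klFun.comp (Kernel.measurable_rnDeriv κ η).ennreal_toReal).ennreal_ofReal

lemma klDiv_kernel_eq_lintegral [MeasurableSpace.CountableOrCountablyGenerated α β]
    (κ η : Kernel α β) [IsFiniteKernel κ] [IsFiniteKernel η] {a : α} (h : κ a ≪ η a) :
    klDiv (κ a) (η a) = ∫⁻ b, ENNReal.ofReal (klFun (κ.rnDeriv η a b).toReal) ∂η a := by
  rw [klDiv_eq_lintegral_klFun_of_ac h]
  refine lintegral_congr_ae ?_
  filter_upwards [Kernel.rnDeriv_eq_rnDeriv_measure (κ := κ) (η := η) (a := a)] with b hb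
  rw [hb]

/-- The integral formula for the divergence is valid only under absolute continuity; elsewhere the
value is ∞. Measurability follows because the set of parameters with absolute continuity is
measurable. -/
lemma measurable_klDiv_kernel [MeasurableSpace.CountableOrCountablyGenerated α β]
    (κ η : Kernel α β) [IsFiniteKernel κ] [IsFiniteKernel η] :
    Measurable fun a => klDiv (κ a) (η a) := by
  classical
  have : (fun a => klDiv (κ a) (η a)) = fun a => if κ a ≪ η a then
      ∫⁻ b, ENNReal.ofReal (klFun (κ.rnDeriv η a b).toReal) ∂η a else ∞ := by
    ext a
    split_ifs with h
    · exact klDiv_kernel_eq_lintegral κ η h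
    · exact klDiv_of_not_ac h
  rw [this]
  exact Measurable.ite (Kernel.measurableSet_absolutelyContinuous κ η)
    (measurable_lintegral_klFun κ η) measurable_const

lemma compProd_eq_withDensity_rnDeriv [MeasurableSpace.CountableOrCountablyGenerated α β]
    (μ : Measure α) [IsFiniteMeasure μ] (κ η : Kernel α β) [IsFiniteKernel κ] [IsFiniteKernel η]
    (h : ∀ᵐ a ∂μ, κ a ≪ η a) :
    μ ⊗ₘ κ = (μ ⊗ₘ η).withDensity fun p => κ.rnDeriv η p.1 p.2 := by
  have hm := Kernel.measurable_rnDeriv κ η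
  refine Measure.ext_of_lintegral _ fun f hf => ?_
  rw [lintegral_withDensity_eq_lintegral_mul _ hm hf, Measure.lintegral_compProd hf,
    Measure.lintegral_compProd (hm.mul hf)]
  refine lintegral_congr_ae ?_
  filter_upwards [h] with a ha
  conv_lhs => rw [← Kernel.withDensity_rnDeriv_eq ha]
  rw [Kernel.withDensity_apply _ hm]
  exact lintegral_withDensity_eq_lintegral_mul _
    (Kernel.measurable_rnDeriv_right κ η a) (hf.comp measurable_prodMk_left)

/-- The conditional Kullback–Leibler divergence is the average of the pointwise divergences. -/
theorem klDiv_compProd_right [MeasurableSpace.CountableOrCountablyGenerated α β]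
    (μ : Measure α) [IsFiniteMeasure μ] (κ η : Kernel α β) [IsMarkovKernel κ] [IsMarkovKernel η] :
    klDiv (μ ⊗ₘ κ) (μ ⊗ₘ η) = ∫⁻ a, klDiv (κ a) (η a) ∂μ := by
  by_cases h : ∀ᵐ a ∂μ, κ a ≪ η a
  · have hm := Kernel.measurable_rnDeriv κ η
    rw [klDiv_eq_lintegral_klFun_of_ac (Measure.absolutelyContinuous_compProd_right_iff.2 h)]
    have hr : (μ ⊗ₘ κ).rnDeriv (μ ⊗ₘ η) =ᵐ[μ ⊗ₘ η] fun p => κ.rnDeriv η p.1 p.2 := by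
      rw [compProd_eq_withDensity_rnDeriv μ κ η h]
      exact Measure.rnDeriv_withDensity _ hm
    rw [lintegral_congr_ae (g := fun p : α × β =>
      ENNReal.ofReal (klFun (κ.rnDeriv η p.1 p.2).toReal))
      (by filter_upwards [hr] with p hp; rw [hp]), Measure.lintegral_compProd
      (by exact (measurable_klFun.comp hm.ennreal_toReal).ennreal_ofReal)]
    refine lintegral_congr_ae ?_
    filter_upwards [h] with a ha
    exact (klDiv_kernel_eq_lintegral κ η ha).symm
  -- Without a.e. absolute continuity both sides are ∞: the integrand is infinite on a set that is
  -- not null.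
  · rw [klDiv_of_not_ac (mt Measure.absolutelyContinuous_compProd_right_iff.1 h)]
    refine (lintegral_eq_top_of_measure_eq_top_ne_zero
      (measurable_klDiv_kernel κ η).aemeasurable fun h0 => h ?_).symm
    rw [ae_iff]
    refine measure_mono_null (fun a ha => ?_) h0
    exact klDiv_of_not_ac ha

lemma klDiv_prod [MeasurableSpace.CountableOrCountablyGenerated α β]
    (μ μ' : Measure α) (ν ν' : Measure β) [IsProbabilityMeasure μ] [IsProbabilityMeasure μ']
    [IsProbabilityMeasure ν] [IsProbabilityMeasure ν'] :
    klDiv (μ.prod ν) (μ'.prod ν') = klDiv μ μ' + klDiv ν ν' := by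
  rw [← Measure.compProd_const, ← Measure.compProd_const, klDiv_compProd_eq_add,
    klDiv_compProd_right]
  simp

/-- Young's inequality for the conjugate pair r log r − r and exp; it is 1 + x ≤ eˣ at x = a − log
r, multiplied by r. -/
lemma mul_sub_exp_le_klFun (a : ℝ) {r : ℝ} (hr : 0 ≤ r) : r * a - Real.exp a + 1 ≤ klFun r := by
  rw [klFun_apply]
  rcases hr.eq_or_lt with rfl | hr
  · have := Real.exp_pos a
    simp; linarith
  · have h1 : Real.exp a = r * Real.exp (a - Real.log r) := by
      rw [Real.exp_sub, Real.exp_log hr]; field_simp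
    have h2 := mul_le_mul_of_nonneg_left (Real.add_one_le_exp (a - Real.log r)) hr.le
    rw [h1]; nlinarith

/-- A form of Fano's inequality: an event of probability `1 / M` under `ν` has small probability
under `μ` unless `D(μ ‖ ν)` is of order `log M`. -/
theorem mul_log_le_klDiv_add_log_two (μ ν : Measure α) [IsProbabilityMeasure μ]
    [IsProbabilityMeasure ν] {A : Set α} (hA : MeasurableSet A) {M : ℝ} (hM : 1 ≤ M)
    (hν : ν.real A = M⁻¹) :
    ENNReal.ofReal (μ.real A * Real.log M) ≤ klDiv μ ν + ENNReal.ofReal (Real.log 2) := by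
  by_cases htop : klDiv μ ν = ∞
  · simp [htop]
  obtain ⟨hac, hint⟩ := klDiv_ne_top_iff.1 htop
  rw [← ENNReal.ofReal_toReal htop, ← ENNReal.ofReal_add ENNReal.toReal_nonneg
    (Real.log_nonneg one_le_two)]
  refine ENNReal.ofReal_le_ofReal ?_
  rw [toReal_klDiv_eq_integral_klFun hac]
  set r : α → ℝ := fun x => (μ.rnDeriv ν x).toReal with hr
  -- The test function of the variational bound. Its exponential is dominated by `b`, whose
  -- ν-integral is (M · M⁻¹ + 1)/2 = 1, so the terms −∫b + 1 cancel and only the μ-mean of `a`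
  -- remains.
  set a : α → ℝ := fun x => A.indicator (fun _ => Real.log M) x - Real.log 2 with ha
  set b : α → ℝ := fun x => (A.indicator (fun _ => M) x + 1) / 2 with hb
  have hM0 : 0 < M := one_pos.trans_le hM
  have hab : ∀ x, Real.exp (a x) ≤ b x := by
    intro x
    by_cases hx : x ∈ A <;> simp [ha, hb, hx, Real.exp_sub, Real.exp_log, hM0]
    · rw [div_le_div_iff_of_pos_right two_pos]; linarith
    · norm_num [Real.exp_neg, Real.exp_log]
  have hai : ∀ ρ : Measure α, IsProbabilityMeasure ρ → Integrable a ρ := fun ρ _ =>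
    ((integrable_const _).indicator hA).sub (integrable_const _)
  have hbi : Integrable b ν :=
    (((integrable_const _).indicator hA).add (integrable_const _)).div_const _
  have hra : Integrable (fun x => r x * a x) ν := (integrable_toReal_rnDeriv_mul_iff hac).2
    (hai μ inferInstance)
  have h1 : ∫ x, r x * a x ∂ν = μ.real A * Real.log M - Real.log 2 := by
    have : ∫ x, r x * a x ∂ν = ∫ x, a x ∂μ := integral_rnDeriv_smul hac
    rw [this, integral_sub ((integrable_const _).indicator hA) (integrable_const _),
      integral_indicator hA]
    simp
  have h2 : ∫ x, b x ∂ν = 1 := by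
    rw [integral_div, integral_add ((integrable_const _).indicator hA) (integrable_const _),
      integral_indicator hA]
    simp [hν, inv_mul_cancel₀ hM0.ne']
  have h3 : ∫ x, (r x * a x - b x + 1) ∂ν ≤ ∫ x, klFun (r x) ∂ν := by
    refine integral_mono ((hra.sub hbi).add (integrable_const _))
      ((integrable_klFun_rnDeriv_iff hac).2 hint) fun x => ?_
    have := mul_sub_exp_le_klFun (a x) (r := r x) ENNReal.toReal_nonneg
    have := hab x
    show r x * a x - b x + 1 ≤ klFun (r x)
    linarith
  have h4 : ∫ x, (r x * a x - b x + 1) ∂ν = μ.real A * Real.log M - Real.log 2 := by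
    rw [← h1, ← add_zero (∫ x, r x * a x ∂ν), ← sub_self (∫ x, b x ∂ν), ← add_sub_assoc,
      add_sub_right_comm, ← integral_sub hra hbi]
    rw [h2]
    refine (integral_add (hra.sub hbi) (integrable_const _)).trans ?_
    simp
  linarith

end Tools

end InformationTheory

namespace MIMORelay

open InformationTheory

/-! ### Divergence of shifted Gaussian noise. -/

lemma integral_exp_gaussianReal (m : ℝ) {v : ℝ≥0} (hv : v ≠ 0) :
    ∫ x, Real.exp (m / v * x) ∂gaussianReal 0 v = Real.exp (m ^ 2 / (2 * v)) := by
  have hv' : (v : ℝ) ≠ 0 := by exact_mod_cast hv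
  have := congrFun (mgf_id_gaussianReal (μ := 0) (v := v)) (m / v)
  simp only [mgf, id] at this
  rw [this]
  congr 1
  field_simp
  ring

/-- Completing the square in the exponent. In this form the log-likelihood ratio is affine, which
makes the divergence explicit. -/
lemma gaussianReal_eq_tilted (m : ℝ) {v : ℝ≥0} (hv : v ≠ 0) :
    gaussianReal m v = (gaussianReal 0 v).tilted fun x => m / v * x := by
  have hv' : (v : ℝ) ≠ 0 := by exact_mod_cast hv
  have hint := integral_exp_gaussianReal m hv
  rw [Measure.tilted, hint, gaussianReal_of_var_ne_zero _ hv, gaussianReal_of_var_ne_zero _ hv,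
    ← withDensity_mul _ (measurable_gaussianPDF _ _) (by fun_prop)]
  congr 1
  ext x
  rw [Pi.mul_apply, gaussianPDF, gaussianPDF, ← ENNReal.ofReal_mul (gaussianPDFReal_nonneg _ _ _),
    gaussianPDFReal, gaussianPDFReal, ← Real.exp_sub, mul_assoc (Real.sqrt _)⁻¹, ← Real.exp_add]
  congr 3
  field_simp
  ring

lemma klDiv_gaussianReal (m : ℝ) {v : ℝ≥0} (hv : v ≠ 0) :
    klDiv (gaussianReal m v) (gaussianReal 0 v)
      = ENNReal.ofReal (m ^ 2 / (2 * v)) := by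
  have hv' : (v : ℝ) ≠ 0 := by exact_mod_cast hv
  have hexp : Integrable (fun x => Real.exp (m / v * x)) (gaussianReal 0 v) :=
    integrable_exp_mul_gaussianReal _
  have hint := integral_exp_gaussianReal m hv
  have hac : gaussianReal m v ≪ gaussianReal 0 v := by
    rw [gaussianReal_eq_tilted m hv]; exact tilted_absolutelyContinuous _ _
  have hllr : llr (gaussianReal m v) (gaussianReal 0 v) =ᵐ[gaussianReal m v]
      fun x => m / v * x - m ^ 2 / (2 * v) := by
    refine hac.ae_le ?_
    have := log_rnDeriv_tilted_left_self hexp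
    rw [hint, Real.log_exp] at this
    rw [gaussianReal_eq_tilted m hv]
    exact this
  have hid : Integrable (fun x : ℝ => x) (gaussianReal m v) :=
    memLp_one_iff_integrable.1 (memLp_id_gaussianReal 1)
  have hi : Integrable (fun x => m / v * x - m ^ 2 / (2 * v)) (gaussianReal m v) :=
    (hid.const_mul _).sub (integrable_const _)
  rw [klDiv_of_ac_of_integrable hac ((integrable_congr hllr).2 hi),
    integral_congr_ae hllr, integral_sub (hid.const_mul _) (integrable_const _),
    integral_const_mul, integral_id_gaussianReal]
  congr 1
  simp
  field_simp
  ring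

/-- Real and imaginary parts contribute independently, and variance 1/2 makes m²/(2v) equal to m².
-/
lemma klDiv_stdComplexGaussian_map_add (c : ℂ) :
    klDiv (stdComplexGaussian.map (c + ·)) stdComplexGaussian = ‖c‖ₑ ^ 2 := by
  have h : stdComplexGaussian.map (c + ·) = ((gaussianReal c.re (1 / 2)).prod
      (gaussianReal c.im (1 / 2))).map Complex.measurableEquivRealProd.symm := by
    have h1 : ∀ x : ℝ, (gaussianReal 0 (1 / 2)).map (x + ·) = gaussianReal x (1 / 2) := fun x => by
      rw [gaussianReal_map_const_add, zero_add]
    rw [stdComplexGaussian, ← h1 c.re, ← h1 c.im, Measure.map_prod_map _ _ (by fun_prop)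
      (by fun_prop), Measure.map_map (by fun_prop) (MeasurableEquiv.measurable _),
      Measure.map_map (MeasurableEquiv.measurable _) (by fun_prop)]
    congr 1
  rw [h, stdComplexGaussian, klDiv_map_measurableEquiv,
    klDiv_prod, klDiv_gaussianReal _ (by norm_num),
    klDiv_gaussianReal _ (by norm_num), ← ENNReal.ofReal_add (by positivity) (by positivity),
    ← ofReal_norm, ← ENNReal.ofReal_pow (norm_nonneg _), Complex.sq_norm,
    Complex.normSq_apply]
  congr 1
  push_cast
  ring

lemma klDiv_pi {n : ℕ} {E : Type*} [MeasurableSpace E] [StandardBorelSpace E]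
    (μ ν : Fin n → Measure E) [∀ i, IsProbabilityMeasure (μ i)]
    [∀ i, IsProbabilityMeasure (ν i)] :
    klDiv (Measure.pi μ) (Measure.pi ν)
      = ∑ i, klDiv (μ i) (ν i) := by
  induction n with
  | zero => simp [Measure.pi_of_empty μ, Measure.pi_of_empty ν]
  | succ n ih =>
    rw [← klDiv_map_measurableEquiv _ _
      (MeasurableEquiv.piFinSuccAbove (fun _ => E) 0),
      (measurePreserving_piFinSuccAbove μ 0).map_eq, (measurePreserving_piFinSuccAbove ν 0).map_eq,
      klDiv_prod, Fin.sum_univ_succ]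
    congr 1
    exact ih _ _

lemma klDiv_noise_map_add {r : ℕ} (v : CVec r) :
    klDiv ((noise r).map (v + ·)) (noise r) = energy v := by
  have h : (noise r).map (v + ·) = Measure.pi fun k => stdComplexGaussian.map (v k + ·) := by
    rw [← Measure.pi_map_pi (fun k => by fun_prop)]
    rfl
  have (k : Fin r) : IsProbabilityMeasure (stdComplexGaussian.map (v k + ·)) :=
    Measure.isProbabilityMeasure_map (by fun_prop)
  rw [h, noise, klDiv_pi]
  simp_rw [klDiv_stdComplexGaussian_map_add]
  rfl

/-! ### Mutual information as an averaged divergence to a reference law. -/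

section Information

variable {Ω α β γ : Type*} [MeasurableSpace Ω] [MeasurableSpace α] [MeasurableSpace β]
  [MeasurableSpace γ] {μ : Measure Ω} [IsProbabilityMeasure μ]
  {X : Ω → α} {Y : Ω → β} {Z : Ω → γ}

lemma mutualInfo_eq_lintegral [MeasurableSpace.CountableOrCountablyGenerated α β]
    (hX : Measurable X) (hY : Measurable Y) (W : Kernel α β) [IsMarkovKernel W]
    (hW : μ.map (fun ω => (X ω, Y ω)) = μ.map X ⊗ₘ W) :
    mutualInfo μ X Y
      = (∫⁻ a, klDiv (W a) (μ.map Y) ∂μ.map X) / ENNReal.ofReal (Real.log 2) := by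
  have := Measure.isProbabilityMeasure_map hX.aemeasurable (μ := μ)
  have := Measure.isProbabilityMeasure_map hY.aemeasurable (μ := μ)
  rw [mutualInfo, hW, ← Measure.compProd_const, klDiv_compProd_right]
  rfl

/-- Expanding D(P_{X,Y} ‖ P_X × Q) by the chain rule from the side of Y gives D(P_Y ‖ Q) plus a term
free of Q. Taking Q = P_Y identifies that term with the mutual information, so the excess is D(P_Y ‖
Q) ≥ 0. -/
lemma mutualInfo_le_lintegral [StandardBorelSpace α] [Nonempty α]
    [MeasurableSpace.CountableOrCountablyGenerated α β]
    (hX : Measurable X) (hY : Measurable Y) (W : Kernel α β) [IsMarkovKernel W]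
    (hW : μ.map (fun ω => (X ω, Y ω)) = μ.map X ⊗ₘ W) (Q : Measure β) [IsProbabilityMeasure Q] :
    mutualInfo μ X Y ≤ (∫⁻ a, klDiv (W a) Q ∂μ.map X) / ENNReal.ofReal (Real.log 2) := by
  have := Measure.isProbabilityMeasure_map hX.aemeasurable (μ := μ)
  have := Measure.isProbabilityMeasure_map hY.aemeasurable (μ := μ)
  have := Measure.isProbabilityMeasure_map (hX.prodMk hY).aemeasurable (μ := μ)
  have hQ (Q : Measure β) [IsProbabilityMeasure Q] :
      klDiv (μ.map fun ω => (X ω, Y ω)) ((μ.map X).prod Q) = klDiv (μ.map Y) Q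
        + klDiv (μ.map Y ⊗ₘ condDistrib X Y μ) (μ.map Y ⊗ₘ Kernel.const β (μ.map X)) := by
    rw [← klDiv_compProd_eq_add, compProd_map_condDistrib hX.aemeasurable,
      Measure.compProd_const, ← klDiv_map_measurableEquiv _ _ MeasurableEquiv.prodComm]
    congr 1
    · rw [Measure.map_map (MeasurableEquiv.measurable _) (hX.prodMk hY)]
      rfl
    · exact Measure.prod_swap
  have hW' : ∫⁻ a, klDiv (W a) Q ∂μ.map X
      = klDiv (μ.map fun ω => (X ω, Y ω)) ((μ.map X).prod Q) := by
    rw [hW, ← Measure.compProd_const, klDiv_compProd_right]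
    rfl
  rw [mutualInfo, hW', hQ, hQ, klDiv_self, zero_add]
  gcongr
  exact le_add_self

variable [StandardBorelSpace α] [Nonempty α] [StandardBorelSpace β] [Nonempty β]

omit [Nonempty β] in
-- Both laws of (Z, X, Y) have the same (Z, X)-marginal, so only the conditional laws of Y differ;
-- under the reference law this conditional law ignores X.
lemma klDiv_compProd_prodMk_eq_lintegral (hX : Measurable X) (hZ : Measurable Z)
    (hY : Measurable Y) (W : Kernel (γ × α) β) [IsMarkovKernel W]
    (hW : μ.map (fun ω => ((Z ω, X ω), Y ω)) = μ.map (fun ω => (Z ω, X ω)) ⊗ₘ W)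
    (Q : Kernel γ β) [IsMarkovKernel Q] :
    klDiv (μ.map fun ω => (Z ω, X ω, Y ω)) (μ.map Z ⊗ₘ (condDistrib X Z μ ×ₖ Q))
      = ∫⁻ p, klDiv (W p) (Q p.1) ∂μ.map fun ω => (Z ω, X ω) := by
  have := Measure.isProbabilityMeasure_map hZ.aemeasurable (μ := μ)
  have := Measure.isProbabilityMeasure_map (hZ.prodMk hX).aemeasurable (μ := μ)
  have h1 : (μ.map fun ω => (Z ω, X ω, Y ω))
      = (μ.map (fun ω => (Z ω, X ω)) ⊗ₘ W).map MeasurableEquiv.prodAssoc := by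
    rw [← hW, Measure.map_map (MeasurableEquiv.measurable _) ((hZ.prodMk hX).prodMk hY)]
    rfl
  have h2 : μ.map Z ⊗ₘ (condDistrib X Z μ ×ₖ Q)
      = (μ.map (fun ω => (Z ω, X ω)) ⊗ₘ Q.prodMkRight α).map MeasurableEquiv.prodAssoc := by
    rw [← compProd_map_condDistrib hX.aemeasurable]
    refine Measure.ext_of_lintegral _ fun f hf => ?_
    have hf' : Measurable fun p : (γ × α) × β => f (p.1.1, p.1.2, p.2) := by fun_prop
    rw [lintegral_map hf (MeasurableEquiv.measurable _), Measure.lintegral_compProd hf]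
    change _ = ∫⁻ p : (γ × α) × β, f (p.1.1, p.1.2, p.2) ∂_
    rw [Measure.lintegral_compProd hf', Measure.lintegral_compProd hf'.lintegral_kernel_prod_right']
    refine lintegral_congr fun z => ?_
    rw [Kernel.prod_apply, lintegral_prod (fun p => f (z, p)) (by fun_prop)]
    rfl
  rw [h1, h2, klDiv_map_measurableEquiv, klDiv_compProd_right]
  rfl

lemma condMutualInfo_eq_lintegral (hX : Measurable X) (hZ : Measurable Z)
    (hY : Measurable Y) (W : Kernel (γ × α) β) [IsMarkovKernel W]
    (hW : μ.map (fun ω => ((Z ω, X ω), Y ω)) = μ.map (fun ω => (Z ω, X ω)) ⊗ₘ W) :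
    condMutualInfo μ X Y Z = (∫⁻ p, klDiv (W p) (condDistrib Y Z μ p.1)
      ∂μ.map fun ω => (Z ω, X ω)) / ENNReal.ofReal (Real.log 2) := by
  rw [condMutualInfo, klDiv_compProd_prodMk_eq_lintegral hX hZ hY W hW]

/-- The same argument conditionally on Z: the excess over the conditional mutual information is the
divergence between the law of (Z, Y) and the one built from `Q`. -/
lemma condMutualInfo_le_lintegral (hX : Measurable X) (hZ : Measurable Z)
    (hY : Measurable Y) (W : Kernel (γ × α) β) [IsMarkovKernel W]
    (hW : μ.map (fun ω => ((Z ω, X ω), Y ω)) = μ.map (fun ω => (Z ω, X ω)) ⊗ₘ W)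
    (Q : Kernel γ β) [IsMarkovKernel Q] :
    condMutualInfo μ X Y Z ≤ (∫⁻ p, klDiv (W p) (Q p.1) ∂μ.map fun ω => (Z ω, X ω))
      / ENNReal.ofReal (Real.log 2) := by
  have := Measure.isProbabilityMeasure_map hZ.aemeasurable (μ := μ)
  have := Measure.isProbabilityMeasure_map (hZ.prodMk hY).aemeasurable (μ := μ)
  -- The chain rule must split off (Z, Y) first, so X is moved to the last place.
  let e : (γ × β) × α → γ × α × β := fun p => (p.1.1, p.2, p.1.2)
  have he : Measurable e := by fun_prop
  let e' : (γ × β) × α ≃ᵐ γ × α × β :=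
    { toFun := e
      invFun := fun p => ((p.1, p.2.2), p.2.1)
      left_inv := fun _ => rfl
      right_inv := fun _ => rfl
      measurable_toFun := he
      measurable_invFun := by
        show Measurable fun p : γ × α × β => ((p.1, p.2.2), p.2.1)
        fun_prop }
  have hchain (Q : Kernel γ β) [IsMarkovKernel Q] :
      klDiv (μ.map fun ω => (Z ω, X ω, Y ω)) (μ.map Z ⊗ₘ (condDistrib X Z μ ×ₖ Q))
      = klDiv (μ.map fun ω => (Z ω, Y ω)) (μ.map Z ⊗ₘ Q)
        + klDiv ((μ.map fun ω => (Z ω, Y ω)) ⊗ₘ condDistrib X (fun ω => (Z ω, Y ω)) μ)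
          ((μ.map fun ω => (Z ω, Y ω)) ⊗ₘ (condDistrib X Z μ).prodMkRight β) := by
    rw [← klDiv_compProd_eq_add, ← klDiv_map_measurableEquiv _ _ e',
      compProd_map_condDistrib hX.aemeasurable,
      Measure.map_map e'.measurable ((hZ.prodMk hY).prodMk hX)]
    congr 1
    refine Measure.ext_of_lintegral _ fun f hf => ?_
    have hf' : Measurable fun p => f (e p) := hf.comp he
    rw [lintegral_map hf e'.measurable, Measure.lintegral_compProd hf]
    change _ = ∫⁻ p, f (e p) ∂_
    rw [Measure.lintegral_compProd hf', Measure.lintegral_compProd hf'.lintegral_kernel_prod_right']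
    refine lintegral_congr fun z => ?_
    rw [Kernel.prod_apply, lintegral_prod_symm (fun p => f (z, p)) (by fun_prop)]
    rfl
  rw [condMutualInfo, ← klDiv_compProd_prodMk_eq_lintegral hX hZ hY W hW, hchain, hchain,
    compProd_map_condDistrib hY.aemeasurable, klDiv_self, zero_add]
  gcongr
  exact le_add_self

end Information

/-! ### Gaussian noise channels as kernels, and the joint laws they produce. -/

section AdditiveNoise

variable {α β γ Ω : Type*} [MeasurableSpace α] [MeasurableSpace β] [MeasurableSpace γ]
  [MeasurableSpace Ω]

/-- The law of an input together with the output of a channel whose noise is independent of the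
input. -/
lemma map_prodMk_eq_compProd (ν : Measure Ω) [SFinite ν] (N : Measure γ) [SFinite N]
    {V : Ω → α} (hV : Measurable V) {F : α × γ → β} (hF : Measurable F) (K : Kernel α β)
    [IsSFiniteKernel K] (hK : ∀ a, K a = N.map fun z => F (a, z)) :
    (ν.prod N).map (fun ω => (V ω.1, F (V ω.1, ω.2))) = ν.map V ⊗ₘ K := by
  refine Measure.ext_of_lintegral _ fun f hf => ?_
  have hm : Measurable fun ω : Ω × γ => (V ω.1, F (V ω.1, ω.2)) := by fun_prop
  rw [lintegral_map hf hm,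
    lintegral_prod (fun ω : Ω × γ => f (V ω.1, F (V ω.1, ω.2))) (hf.comp hm).aemeasurable,
    Measure.lintegral_compProd hf, lintegral_map hf.lintegral_kernel_prod_right' hV]
  refine lintegral_congr fun a => ?_
  rw [hK, lintegral_map (f := fun y => f (V a, y)) (by fun_prop) (by fun_prop)]

/-- The channel that adds Gaussian noise to the signal `g a`. -/
def awgn {r : ℕ} (g : α → CVec r) : Kernel α (CVec r) :=
  (Kernel.id ×ₖ Kernel.const α (noise r)).map fun p => g p.1 + p.2

lemma isMarkovKernel_awgn {r : ℕ} {g : α → CVec r} (hg : Measurable g) :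
    IsMarkovKernel (awgn g) :=
  Kernel.IsMarkovKernel.map _ (by fun_prop)

lemma awgn_apply {r : ℕ} {g : α → CVec r} (hg : Measurable g) (a : α) :
    awgn g a = (noise r).map (g a + ·) := by
  rw [awgn, Kernel.map_apply _ (by fun_prop), Kernel.prod_apply, Kernel.id_apply,
    Kernel.const_apply, Measure.dirac_prod, Measure.map_map (by fun_prop) (by fun_prop)]
  rfl

lemma awgn_comp_apply {α β : Type*} [MeasurableSpace α] [MeasurableSpace β] {r : ℕ}
    {g : α → CVec r} (hg : Measurable g) {f : β → α} (hf : Measurable f) (b : β) :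
    awgn (fun b => g (f b)) b = awgn g (f b) := by
  rw [awgn_apply hg, awgn_apply (g := fun b => g (f b)) (by fun_prop)]

end AdditiveNoise

section Laws

variable {α Ω : Type*} [MeasurableSpace α] [MeasurableSpace Ω] {r₂ r₃ : ℕ}
  (ν : Measure Ω) [SFinite ν] {V : Ω → α} {g₂ : α → CVec r₂} {g₃ : α → CVec r₃}

lemma map_awgn_fst (hV : Measurable V) (hg₂ : Measurable g₂) :
    (ν.prod ((noise r₂).prod (noise r₃))).map (fun ω => (V ω.1, g₂ (V ω.1) + ω.2.1))
      = ν.map V ⊗ₘ awgn g₂ := by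
  have := isMarkovKernel_awgn hg₂
  refine map_prodMk_eq_compProd ν _ hV (F := fun p : α × CVec r₂ × CVec r₃ => g₂ p.1 + p.2.1)
    (by fun_prop) _ fun a => ?_
  conv_lhs => rw [awgn_apply hg₂, ← Measure.fst_prod (μ := noise r₂) (ν := noise r₃),
    Measure.fst, Measure.map_map (by fun_prop) measurable_fst]
  rfl

lemma map_awgn_snd (hV : Measurable V) (hg₃ : Measurable g₃) :
    (ν.prod ((noise r₂).prod (noise r₃))).map (fun ω => (V ω.1, g₃ (V ω.1) + ω.2.2))
      = ν.map V ⊗ₘ awgn g₃ := by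
  have := isMarkovKernel_awgn hg₃
  refine map_prodMk_eq_compProd ν _ hV (F := fun p : α × CVec r₂ × CVec r₃ => g₃ p.1 + p.2.2)
    (by fun_prop) _ fun a => ?_
  conv_lhs => rw [awgn_apply hg₃, ← Measure.snd_prod (μ := noise r₂) (ν := noise r₃),
    Measure.snd, Measure.map_map (by fun_prop) measurable_snd]
  rfl

lemma awgn_prod_apply (hg₂ : Measurable g₂) (hg₃ : Measurable g₃) (a : α) :
    (awgn g₂ ×ₖ awgn g₃) a
      = ((noise r₂).prod (noise r₃)).map fun z => (g₂ a + z.1, g₃ a + z.2) := by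
  have := isMarkovKernel_awgn hg₂
  have := isMarkovKernel_awgn hg₃
  rw [Kernel.prod_apply, awgn_apply hg₂, awgn_apply hg₃,
    Measure.map_prod_map _ _ (by fun_prop) (by fun_prop)]
  rfl

lemma map_awgn_prod (hV : Measurable V) (hg₂ : Measurable g₂) (hg₃ : Measurable g₃) :
    (ν.prod ((noise r₂).prod (noise r₃))).map
        (fun ω => (V ω.1, g₂ (V ω.1) + ω.2.1, g₃ (V ω.1) + ω.2.2))
      = ν.map V ⊗ₘ (awgn g₂ ×ₖ awgn g₃) := by
  have := isMarkovKernel_awgn hg₂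
  have := isMarkovKernel_awgn hg₃
  exact map_prodMk_eq_compProd ν _ hV
    (F := fun p : α × CVec r₂ × CVec r₃ => (g₂ p.1 + p.2.1, g₃ p.1 + p.2.2))
    (by fun_prop) _ (awgn_prod_apply hg₂ hg₃)

end Laws

@[fun_prop]
lemma measurable_mulVec {α : Type*} [MeasurableSpace α] {m n : ℕ} (A : Matrix (Fin m) (Fin n) ℂ)
    {f : α → CVec n} (hf : Measurable f) : Measurable fun a => A *ᵥ f a :=
  (Continuous.matrix_mulVec continuous_const continuous_id).measurable.comp hf

@[fun_prop]
lemma measurable_energy {n : ℕ} : Measurable (energy (n := n)) := by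
  unfold energy; fun_prop

lemma map_prod_fst {Ω Ω' α : Type*} [MeasurableSpace Ω] [MeasurableSpace Ω'] [MeasurableSpace α]
    (ν : Measure Ω) (N : Measure Ω') [IsProbabilityMeasure N] {V : Ω → α} (hV : Measurable V) :
    (ν.prod N).map (fun ω => V ω.1) = ν.map V := by
  rw [← Function.comp_def V Prod.fst, ← Measure.map_map hV measurable_fst, ← Measure.fst,
    Measure.fst_prod]

/-- Used to identify I(X₁,X₂;Y₃) on the sample spaces with and without U. -/
lemma mutualInfo_congr {Ω Ω' α β : Type*} [MeasurableSpace Ω] [MeasurableSpace Ω']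
    [MeasurableSpace α] [MeasurableSpace β] {μ : Measure Ω} {μ' : Measure Ω'}
    {X : Ω → α} {Y : Ω → β} {X' : Ω' → α} {Y' : Ω' → β} (hX : Measurable X) (hY : Measurable Y)
    (hX' : Measurable X') (hY' : Measurable Y')
    (h : μ.map (fun ω => (X ω, Y ω)) = μ'.map fun ω => (X' ω, Y' ω)) :
    mutualInfo μ X Y = mutualInfo μ' X' Y' := by
  have h1 : μ.map X = μ'.map X' := by
    have := congrArg (Measure.map Prod.fst) h
    rwa [Measure.map_map measurable_fst (hX.prodMk hY),
      Measure.map_map measurable_fst (hX'.prodMk hY')] at this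
  have h2 : μ.map Y = μ'.map Y' := by
    have := congrArg (Measure.map Prod.snd) h
    rwa [Measure.map_map measurable_snd (hX.prodMk hY),
      Measure.map_map measurable_snd (hX'.prodMk hY')] at this
  rw [mutualInfo, mutualInfo, h, h1, h2]

variable {t₁ t₂ r₂ r₃ : ℕ} (G : Channel t₁ t₂ r₂ r₃)

/-! ### The relay channel and finiteness of both bounds. -/

namespace Channel

/-- The signal part of the relay's observation. -/
def relaySignal (x : CVec t₁ × CVec t₂) : CVec r₂ := G.G₂₁ *ᵥ x.1

/-- The signal part of the receiver's observation. -/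
def recvSignal (x : CVec t₁ × CVec t₂) : CVec r₃ := G.G₃₁ *ᵥ x.1 + G.G₃₂ *ᵥ x.2

@[fun_prop]
lemma measurable_relaySignal : Measurable G.relaySignal := by
  unfold relaySignal; fun_prop

@[fun_prop]
lemma measurable_recvSignal : Measurable G.recvSignal := by
  unfold recvSignal; fun_prop

/-- The channel from the inputs to the relay. -/
abbrev relayKernel : Kernel (CVec t₁ × CVec t₂) (CVec r₂) := awgn G.relaySignal

/-- The channel from the inputs to the receiver. -/
abbrev recvKernel : Kernel (CVec t₁ × CVec t₂) (CVec r₃) := awgn G.recvSignal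

instance : IsMarkovKernel G.relayKernel := isMarkovKernel_awgn G.measurable_relaySignal

instance : IsMarkovKernel G.recvKernel := isMarkovKernel_awgn G.measurable_recvSignal

lemma klDiv_recvKernel_noise (x : CVec t₁ × CVec t₂) :
    klDiv (G.recvKernel x) (noise r₃) = energy (G.recvSignal x) := by
  rw [awgn_apply G.measurable_recvSignal, klDiv_noise_map_add]

lemma energy_recvSignal_le : ∃ C : ℝ≥0, ∀ x : CVec t₁ × CVec t₂,
    energy (G.recvSignal x) ≤ C * (energy x.1 + energy x.2) := by
  let L : (CVec t₁ × CVec t₂) →L[ℂ] CVec r₃ := LinearMap.toContinuousLinearMap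
    ((Matrix.mulVecLin G.G₃₁).coprod (Matrix.mulVecLin G.G₃₂))
  have hL : ∀ x, L x = G.recvSignal x := fun x => rfl
  have hle (n : ℕ) (x : CVec n) : ‖x‖ₑ ^ 2 ≤ energy x := by
    rcases isEmpty_or_nonempty (Fin n) with h | h
    · simp [Subsingleton.elim x 0]
    · obtain ⟨k, hk⟩ := Finite.exists_max fun k => ‖x k‖
      have : ‖x‖ₑ ≤ ‖x k‖ₑ := by
        rw [enorm_le_iff_norm_le]
        exact (pi_norm_le_iff_of_nonneg (norm_nonneg _)).2 hk
      calc ‖x‖ₑ ^ 2 ≤ ‖x k‖ₑ ^ 2 := by gcongr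
        _ ≤ energy x := Finset.single_le_sum (f := fun k => ‖x k‖ₑ ^ 2) (fun _ _ => zero_le)
          (Finset.mem_univ k)
  -- The norms on the vector spaces are sup norms: each of the r₃ output coordinates is at most
  -- ‖L‖‖x‖, and ‖x‖² is at most the total energy.
  refine ⟨r₃ * ‖L‖₊ ^ 2, fun x => ?_⟩
  have h1 : ∀ k, ‖G.recvSignal x k‖ₑ ≤ ‖L‖ₑ * ‖x‖ₑ := fun k =>
    (enorm_le_iff_norm_le.2 (norm_le_pi_norm (G.recvSignal x) k)).trans
      (by rw [← hL]; exact L.le_opENorm x)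
  have h2 : ‖x‖ₑ ^ 2 ≤ energy x.1 + energy x.2 := by
    rcases le_total ‖x.1‖ ‖x.2‖ with h | h
    · have : ‖x‖ₑ ≤ ‖x.2‖ₑ := enorm_le_iff_norm_le.2 (by simp [Prod.norm_def, h])
      calc ‖x‖ₑ ^ 2 ≤ ‖x.2‖ₑ ^ 2 := by gcongr
        _ ≤ _ := (hle _ _).trans le_add_self
    · have : ‖x‖ₑ ≤ ‖x.1‖ₑ := enorm_le_iff_norm_le.2 (by simp [Prod.norm_def, h])
      calc ‖x‖ₑ ^ 2 ≤ ‖x.1‖ₑ ^ 2 := by gcongr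
        _ ≤ _ := (hle _ _).trans le_self_add
  calc energy (G.recvSignal x) ≤ ∑ _k : Fin r₃, (‖L‖ₑ * ‖x‖ₑ) ^ 2 :=
        Finset.sum_le_sum fun k _ => by gcongr; exact h1 k
    _ = r₃ * ‖L‖ₑ ^ 2 * ‖x‖ₑ ^ 2 := by simp [mul_pow, mul_assoc]
    _ ≤ r₃ * ‖L‖ₑ ^ 2 * (energy x.1 + energy x.2) := by gcongr
    _ = _ := by rw [enorm_eq_nnnorm]; push_cast; rfl

/-- A finite bound, uniform over the input distributions that satisfy the power constraint, on
the information that the receiver gets about the inputs. -/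
lemma exists_mutualInfo_le (P : ℝ≥0) : ∃ C : ℝ≥0, ∀ {S : Type} [MeasurableSpace S]
    (ν : Measure S) [IsProbabilityMeasure ν] (V : S → CVec t₁ × CVec t₂), Measurable V →
    ∫⁻ s, energy (V s).1 ∂ν ≤ P → ∫⁻ s, energy (V s).2 ∂ν ≤ P →
    mutualInfo (ν.prod ((noise r₂).prod (noise r₃))) (fun ω => V ω.1)
      (fun ω => G.recvSignal (V ω.1) + ω.2.2) ≤ C := by
  obtain ⟨C, hC⟩ := G.energy_recvSignal_le
  refine ⟨C * (P + P) / (Real.log 2).toNNReal, fun ν _ V hV h1 h2 => ?_⟩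
  have hfst : (ν.prod ((noise r₂).prod (noise r₃))).map (fun ω => V ω.1) = ν.map V :=
    map_prod_fst ν _ hV
  -- The reference law is the output for zero input, so the divergence is the energy of the signal.
  refine (mutualInfo_le_lintegral (by fun_prop) (by fun_prop) G.recvKernel
    (by rw [hfst, map_awgn_snd ν hV G.measurable_recvSignal]) (noise r₃)).trans ?_
  have hlog : (Real.log 2).toNNReal ≠ 0 := by simp [Real.log_pos one_lt_two]
  rw [ENNReal.coe_div hlog, hfst, ENNReal.ofReal]
  gcongr
  simp_rw [klDiv_recvKernel_noise]
  have hm1 : Measurable fun s => energy (V s).1 := measurable_energy.comp (by fun_prop)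
  have hm2 : Measurable fun x => energy (G.recvSignal x) :=
    measurable_energy.comp G.measurable_recvSignal
  rw [lintegral_map hm2 hV]
  calc ∫⁻ s, energy (G.recvSignal (V s)) ∂ν
      ≤ ∫⁻ s, C * (energy (V s).1 + energy (V s).2) ∂ν := lintegral_mono fun s => hC _
    _ = C * (∫⁻ s, energy (V s).1 ∂ν + ∫⁻ s, energy (V s).2 ∂ν) := by
        rw [lintegral_const_mul' _ _ ENNReal.coe_ne_top, lintegral_add_left hm1]
    _ ≤ C * (P + P) := by gcongr
    _ = _ := by push_cast; rfl

theorem RCS_ne_top (P : ℝ≥0) : G.RCS P ≠ ∞ := by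
  obtain ⟨C, hC⟩ := G.exists_mutualInfo_le P
  refine ne_top_of_le_ne_top ENNReal.coe_ne_top (b := (C : ℝ≥0∞)) ?_
  refine iSup_le fun ν => iSup_le fun h1 => iSup_le fun h2 => ?_
  exact (min_le_left _ _).trans (hC (ν : Measure (CVec t₁ × CVec t₂)) id measurable_id h1 h2)

theorem RPDF_ne_top (P : ℝ≥0) : G.RPDF P ≠ ∞ := by
  obtain ⟨C, hC⟩ := G.exists_mutualInfo_le P
  refine ne_top_of_le_ne_top ENNReal.coe_ne_top (b := (C : ℝ≥0∞)) ?_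
  refine iSup_le fun k => iSup_le fun ν => iSup_le fun h1 => iSup_le fun h2 => ?_
  exact (min_le_left _ _).trans
    (hC (ν : Measure (CVec k × CVec t₁ × CVec t₂)) Prod.snd measurable_snd h1 h2)

/-! ### The two cutset terms in terms of reference laws. -/

section Cutset

variable (ν : Measure (CVec t₁ × CVec t₂)) [IsProbabilityMeasure ν]

/-- The second mutual information of the cutset bound, `I(X₁; Y₂, Y₃ | X₂)`. -/
def broadcastInfo : ℝ≥0∞ :=
  condMutualInfo (ν.prod ((noise r₂).prod (noise r₃))) (fun ω => ω.1.1)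
    (fun ω => (G.out₂ ω.1.1 ω.2.1, G.out₃ ω.1.1 ω.1.2 ω.2.2)) (fun ω => ω.1.2)

/-- The first mutual information of both bounds, `I(X₁, X₂; Y₃)`. -/
def multipleAccessInfo : ℝ≥0∞ :=
  mutualInfo (ν.prod ((noise r₂).prod (noise r₃))) (fun ω => (ω.1.1, ω.1.2))
    (fun ω => G.out₃ ω.1.1 ω.1.2 ω.2.2)

lemma cutsetRate_eq (ν : ProbabilityMeasure (CVec t₁ × CVec t₂)) :
    G.cutsetRate ν = min (G.multipleAccessInfo ν) (G.broadcastInfo ν) := rfl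

/-- The channel from the inputs, in the order `(x₂, x₁)`, to the two outputs. -/
abbrev swapKernel : Kernel (CVec t₂ × CVec t₁) (CVec r₂ × CVec r₃) :=
  awgn (fun p : CVec t₂ × CVec t₁ => G.relaySignal p.swap)
    ×ₖ awgn (fun p : CVec t₂ × CVec t₁ => G.recvSignal p.swap)

instance : IsMarkovKernel G.swapKernel :=
  have := isMarkovKernel_awgn (G.measurable_relaySignal.comp (measurable_swap (α := CVec t₂)))
  have := isMarkovKernel_awgn (G.measurable_recvSignal.comp (measurable_swap (α := CVec t₂)))
  inferInstanceAs (IsMarkovKernel (awgn (G.relaySignal ∘ Prod.swap)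
    ×ₖ awgn (G.recvSignal ∘ Prod.swap)))

lemma swapKernel_apply (p : CVec t₂ × CVec t₁) :
    G.swapKernel p = (G.relayKernel ×ₖ G.recvKernel) p.swap := by
  rw [awgn_prod_apply (g₂ := fun p : CVec t₂ × CVec t₁ => G.relaySignal p.swap)
    (g₃ := fun p : CVec t₂ × CVec t₁ => G.recvSignal p.swap) (by fun_prop) (by fun_prop),
    awgn_prod_apply (by fun_prop) (by fun_prop)]

lemma map_swapKernel :
    (ν.prod ((noise r₂).prod (noise r₃))).map (fun ω => ((ω.1.2, ω.1.1),
        (G.out₂ ω.1.1 ω.2.1, G.out₃ ω.1.1 ω.1.2 ω.2.2)))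
      = (ν.prod ((noise r₂).prod (noise r₃))).map (fun ω => (ω.1.2, ω.1.1)) ⊗ₘ G.swapKernel := by
  rw [map_prod_fst ν _ (V := fun x => (x.2, x.1)) (by fun_prop),
    ← map_awgn_prod ν (V := fun x => (x.2, x.1))
      (g₂ := fun p : CVec t₂ × CVec t₁ => G.relaySignal p.swap)
      (g₃ := fun p : CVec t₂ × CVec t₁ => G.recvSignal p.swap)
      (by fun_prop) (by fun_prop) (by fun_prop)]
  rfl

lemma measurable_outputs : Measurable fun ω : (CVec t₁ × CVec t₂) × CVec r₂ × CVec r₃ =>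
    (G.out₂ ω.1.1 ω.2.1, G.out₃ ω.1.1 ω.1.2 ω.2.2) := by
  unfold out₂ out₃; fun_prop

omit [IsProbabilityMeasure ν] in
lemma lintegral_swapKernel (Q : Kernel (CVec t₂) (CVec r₂ × CVec r₃)) [IsMarkovKernel Q] :
    ∫⁻ p, klDiv (G.swapKernel p) (Q p.1)
      ∂(ν.prod ((noise r₂).prod (noise r₃))).map (fun ω => (ω.1.2, ω.1.1))
      = ∫⁻ x, klDiv ((G.relayKernel ×ₖ G.recvKernel) x) (Q x.2) ∂ν := by
  have hm : Measurable fun p => klDiv (G.swapKernel p) (Q p.1) :=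
    measurable_klDiv_kernel G.swapKernel (Q.prodMkRight (CVec t₁))
  rw [map_prod_fst ν _ (V := fun x => (x.2, x.1)) (by fun_prop), lintegral_map hm (by fun_prop)]
  simp_rw [swapKernel_apply]
  rfl

lemma broadcastInfo_le_lintegral (Q : Kernel (CVec t₂) (CVec r₂ × CVec r₃)) [IsMarkovKernel Q] :
    G.broadcastInfo ν ≤ (∫⁻ x, klDiv ((G.relayKernel ×ₖ G.recvKernel) x) (Q x.2) ∂ν)
      / ENNReal.ofReal (Real.log 2) := by
  rw [← G.lintegral_swapKernel ν Q]
  exact condMutualInfo_le_lintegral (by fun_prop) (by fun_prop) G.measurable_outputs G.swapKernel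
    (G.map_swapKernel ν) Q

/-- The witness is the conditional output law given X₂, at which the reference bound is tight. The
converse uses this kernel as a fictitious channel. -/
lemma exists_broadcastInfo_eq : ∃ (Q : Kernel (CVec t₂) (CVec r₂ × CVec r₃)), IsMarkovKernel Q ∧
    G.broadcastInfo ν = (∫⁻ x, klDiv ((G.relayKernel ×ₖ G.recvKernel) x) (Q x.2) ∂ν)
      / ENNReal.ofReal (Real.log 2) := by
  refine ⟨condDistrib (fun ω => (G.out₂ ω.1.1 ω.2.1, G.out₃ ω.1.1 ω.1.2 ω.2.2))
    (fun ω => ω.1.2) (ν.prod ((noise r₂).prod (noise r₃))), inferInstance, ?_⟩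
  rw [← G.lintegral_swapKernel ν]
  exact condMutualInfo_eq_lintegral (by fun_prop) (by fun_prop) G.measurable_outputs
    G.swapKernel (G.map_swapKernel ν)

lemma exists_multipleAccessInfo_eq : ∃ Q : Measure (CVec r₃), IsProbabilityMeasure Q ∧
    G.multipleAccessInfo ν = (∫⁻ x, klDiv (G.recvKernel x) Q ∂ν)
      / ENNReal.ofReal (Real.log 2) := by
  let X : (CVec t₁ × CVec t₂) × CVec r₂ × CVec r₃ → CVec t₁ × CVec t₂ := fun ω => (ω.1.1, ω.1.2)
  let Y : (CVec t₁ × CVec t₂) × CVec r₂ × CVec r₃ → CVec r₃ := fun ω => G.out₃ ω.1.1 ω.1.2 ω.2.2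
  have hX : Measurable X := by fun_prop
  have hY : Measurable Y := measurable_snd.comp G.measurable_outputs
  have hmX : (ν.prod ((noise r₂).prod (noise r₃))).map X = ν :=
    (map_prod_fst ν _ measurable_id).trans Measure.map_id
  have hW : (ν.prod ((noise r₂).prod (noise r₃))).map (fun ω => (X ω, Y ω))
      = (ν.prod ((noise r₂).prod (noise r₃))).map X ⊗ₘ G.recvKernel := by
    have h := map_awgn_snd (r₂ := r₂) ν measurable_id G.measurable_recvSignal
    rw [Measure.map_id] at h
    rw [hmX]
    exact h
  have h := mutualInfo_eq_lintegral hX hY G.recvKernel hW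
  rw [hmX] at h
  exact ⟨_, Measure.isProbabilityMeasure_map hY.aemeasurable, h⟩

/-- The conditional law of (Y₂, Y₃) given X₂ need not be a product, but a product reference law is
still admissible for an upper bound. Given both inputs the outputs are independent, so the
divergence then splits. -/
lemma broadcastInfo_le_add (Q₂ : Kernel (CVec t₂) (CVec r₂)) [IsMarkovKernel Q₂]
    (Q₃ : Kernel (CVec t₂) (CVec r₃)) [IsMarkovKernel Q₃] :
    G.broadcastInfo ν ≤ (∫⁻ x, klDiv (G.relayKernel x) (Q₂ x.2) ∂ν)
        / ENNReal.ofReal (Real.log 2)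
      + (∫⁻ x, klDiv (G.recvKernel x) (Q₃ x.2) ∂ν) / ENNReal.ofReal (Real.log 2) := by
  refine (G.broadcastInfo_le_lintegral ν (Q₂ ×ₖ Q₃)).trans_eq ?_
  have hm : Measurable fun x : CVec t₁ × CVec t₂ => klDiv (G.relayKernel x) (Q₂ x.2) :=
    measurable_klDiv_kernel G.relayKernel (Q₂.prodMkLeft (CVec t₁))
  rw [← ENNReal.add_div, ← lintegral_add_left hm]
  congr 1
  refine lintegral_congr fun x => ?_
  rw [Kernel.prod_apply, Kernel.prod_apply, klDiv_prod]

end Cutset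

/-! ### Two choices of the auxiliary variable U. -/

section PartialDecodeForward

variable (ν : ProbabilityMeasure (CVec t₁ × CVec t₂))

/-- A deterministic U = f(X₁, X₂) leaves the law of (X₁, X₂, Y₃) unchanged, so only the second term
of the rate has to be bounded below. -/
lemma min_multipleAccessInfo_le_pdfRate {k : ℕ} {f : CVec t₁ × CVec t₂ → CVec k}
    (hf : Measurable f) {I : ℝ≥0∞}
    (ν' : ProbabilityMeasure (CVec k × CVec t₁ × CVec t₂))
    (hν' : (ν' : Measure (CVec k × CVec t₁ × CVec t₂))
      = (ν : Measure (CVec t₁ × CVec t₂)).map fun x => (f x, x))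
    (hI : I ≤ condMutualInfo
        ((ν' : Measure (CVec k × CVec t₁ × CVec t₂)).prod ((noise r₂).prod (noise r₃)))
        (fun ω => ω.1.1) (fun ω => G.out₂ ω.1.2.1 ω.2.1) (fun ω => ω.1.2.2)
      + condMutualInfo
        ((ν' : Measure (CVec k × CVec t₁ × CVec t₂)).prod ((noise r₂).prod (noise r₃)))
        (fun ω => ω.1.2.1) (fun ω => G.out₃ ω.1.2.1 ω.1.2.2 ω.2.2) (fun ω => (ω.1.2.2, ω.1.1))) :
    min (G.multipleAccessInfo ν) I ≤ G.pdfRate ν' := by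
  refine min_le_min (le_of_eq ?_) hI
  have hY : Measurable fun ω : (CVec t₁ × CVec t₂) × CVec r₂ × CVec r₃ =>
      G.out₃ ω.1.1 ω.1.2 ω.2.2 := measurable_snd.comp G.measurable_outputs
  have hY' : Measurable fun ω : (CVec k × CVec t₁ × CVec t₂) × CVec r₂ × CVec r₃ =>
      G.out₃ ω.1.2.1 ω.1.2.2 ω.2.2 := by unfold out₃; fun_prop
  refine mutualInfo_congr (by fun_prop) hY (by fun_prop) hY' ?_
  refine (map_awgn_snd (ν : Measure (CVec t₁ × CVec t₂)) measurable_id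
    G.measurable_recvSignal).trans
    (Eq.trans ?_ (map_awgn_snd (ν' : Measure (CVec k × CVec t₁ × CVec t₂)) measurable_snd
      G.measurable_recvSignal).symm)
  rw [hν', Measure.map_map measurable_snd (by fun_prop)]
  rfl

lemma pdfRate_le_RPDF {P : ℝ≥0} {k : ℕ} {f : CVec t₁ × CVec t₂ → CVec k} (hf : Measurable f)
    (ν' : ProbabilityMeasure (CVec k × CVec t₁ × CVec t₂))
    (hν' : (ν' : Measure (CVec k × CVec t₁ × CVec t₂))
      = (ν : Measure (CVec t₁ × CVec t₂)).map fun x => (f x, x))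
    (h₁ : ∫⁻ x, energy x.1 ∂(ν : Measure (CVec t₁ × CVec t₂)) ≤ P)
    (h₂ : ∫⁻ x, energy x.2 ∂(ν : Measure (CVec t₁ × CVec t₂)) ≤ P) :
    G.pdfRate ν' ≤ G.RPDF P := by
  have hm : Measurable fun x : CVec t₁ × CVec t₂ => (f x, x) := by fun_prop
  refine le_iSup₂_of_le k ν' (le_iSup₂_of_le ?_ ?_ le_rfl)
  · rw [hν', lintegral_map (f := fun x => energy x.2.1) (by fun_prop) hm]
    exact h₁
  · rw [hν', lintegral_map (f := fun x => energy x.2.2) (by fun_prop) hm]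
    exact h₂

/-- Decode–forward: the choice `U = X₁`. -/
lemma exists_le_RPDF_of_relay {P : ℝ≥0}
    (h₁ : ∫⁻ x, energy x.1 ∂(ν : Measure (CVec t₁ × CVec t₂)) ≤ P)
    (h₂ : ∫⁻ x, energy x.2 ∂(ν : Measure (CVec t₁ × CVec t₂)) ≤ P) :
    ∃ Q₂ : Kernel (CVec t₂) (CVec r₂), IsMarkovKernel Q₂ ∧
      min (G.multipleAccessInfo ν)
        ((∫⁻ x, klDiv (G.relayKernel x) (Q₂ x.2) ∂(ν : Measure (CVec t₁ × CVec t₂)))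
          / ENNReal.ofReal (Real.log 2)) ≤ G.RPDF P := by
  have hm : Measurable fun x : CVec t₁ × CVec t₂ => (x.1, x) := by fun_prop
  let ν' : ProbabilityMeasure (CVec t₁ × CVec t₁ × CVec t₂) := ν.map hm.aemeasurable
  have hν' : (ν' : Measure (CVec t₁ × CVec t₁ × CVec t₂))
      = (ν : Measure (CVec t₁ × CVec t₂)).map fun x => (x.1, x) := rfl
  set μ := (ν' : Measure (CVec t₁ × CVec t₁ × CVec t₂)).prod ((noise r₂).prod (noise r₃)) with hμ
  have hY : Measurable fun ω : (CVec t₁ × CVec t₁ × CVec t₂) × CVec r₂ × CVec r₃ =>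
      G.out₂ ω.1.2.1 ω.2.1 := by unfold out₂; fun_prop
  have hg : Measurable fun p : CVec t₂ × CVec t₁ => G.relaySignal p.swap := by fun_prop
  have := isMarkovKernel_awgn hg
  have hfst : μ.map (fun ω => (ω.1.2.2, ω.1.1))
      = (ν : Measure (CVec t₁ × CVec t₂)).map fun x => (x.2, x.1) := by
    rw [hμ, map_prod_fst _ _ (V := fun x : CVec t₁ × CVec t₁ × CVec t₂ => (x.2.2, x.1))
      (by fun_prop), hν', Measure.map_map (by fun_prop) hm]
    rfl
  have hW : μ.map (fun ω => ((ω.1.2.2, ω.1.1), G.out₂ ω.1.2.1 ω.2.1))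
      = μ.map (fun ω => (ω.1.2.2, ω.1.1))
        ⊗ₘ awgn (fun p : CVec t₂ × CVec t₁ => G.relaySignal p.swap) := by
    rw [hμ, map_prod_fst _ _ (V := fun x : CVec t₁ × CVec t₁ × CVec t₂ => (x.2.2, x.1))
      (by fun_prop), ← map_awgn_fst (r₃ := r₃) _ (V := fun x : CVec t₁ × CVec t₁ × CVec t₂ =>
      (x.2.2, x.1)) (by fun_prop) hg]
    -- The kernel reads U where the output is formed from X₁; the two agree almost surely because ν'
    -- lives on the diagonal U = X₁.
    refine Measure.map_congr ?_
    have hdiag : ∀ᵐ ω ∂μ, ω.1.1 = ω.1.2.1 := by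
      refine Measure.quasiMeasurePreserving_fst.ae 
        (p := fun x : CVec t₁ × CVec t₁ × CVec t₂ => x.1 = x.2.1) ?_
      rw [hν', ae_map_iff hm.aemeasurable (measurableSet_eq_fun (by fun_prop) (by fun_prop))]
      simp
    filter_upwards [hdiag] with ω hω
    simp [relaySignal, out₂, hω]
  have hI := condMutualInfo_eq_lintegral (μ := μ) (by fun_prop) (by fun_prop) hY _ hW
  let Q := condDistrib (fun ω => G.out₂ ω.1.2.1 ω.2.1) (fun ω => ω.1.2.2) μ
  -- The summand I(X₁;Y₃|X₂,U) is dropped.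
  refine ⟨Q, inferInstance, (G.min_multipleAccessInfo_le_pdfRate ν measurable_fst ν' hν'
    (le_trans (le_of_eq ?_) le_self_add)).trans
    (G.pdfRate_le_RPDF ν measurable_fst ν' hν' h₁ h₂)⟩
  refine Eq.trans ?_ hI.symm
  have hm' : Measurable fun p : CVec t₂ × CVec t₁ =>
      klDiv (awgn (fun p : CVec t₂ × CVec t₁ => G.relaySignal p.swap) p) (Q p.1) :=
    measurable_klDiv_kernel (awgn (fun p : CVec t₂ × CVec t₁ => G.relaySignal p.swap))
      (Q.prodMkRight (CVec t₁))
  rw [hfst, lintegral_map hm' (by fun_prop)]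
  simp_rw [awgn_comp_apply G.measurable_relaySignal measurable_swap]
  rfl

/-- Direct transmission: a constant `U`. -/
lemma exists_le_RPDF_of_recv {P : ℝ≥0}
    (h₁ : ∫⁻ x, energy x.1 ∂(ν : Measure (CVec t₁ × CVec t₂)) ≤ P)
    (h₂ : ∫⁻ x, energy x.2 ∂(ν : Measure (CVec t₁ × CVec t₂)) ≤ P) :
    ∃ Q₃ : Kernel (CVec t₂) (CVec r₃), IsMarkovKernel Q₃ ∧
      min (G.multipleAccessInfo ν)
        ((∫⁻ x, klDiv (G.recvKernel x) (Q₃ x.2) ∂(ν : Measure (CVec t₁ × CVec t₂)))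
          / ENNReal.ofReal (Real.log 2)) ≤ G.RPDF P := by
  -- Dimension 0 makes U a constant, since ℂ⁰ is a single point.
  have hm : Measurable fun x : CVec t₁ × CVec t₂ => ((0 : CVec 0), x) := by fun_prop
  let ν' : ProbabilityMeasure (CVec 0 × CVec t₁ × CVec t₂) := ν.map hm.aemeasurable
  have hν' : (ν' : Measure (CVec 0 × CVec t₁ × CVec t₂))
      = (ν : Measure (CVec t₁ × CVec t₂)).map fun x => (0, x) := rfl
  set μ := (ν' : Measure (CVec 0 × CVec t₁ × CVec t₂)).prod ((noise r₂).prod (noise r₃)) with hμ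
  have hY : Measurable fun ω : (CVec 0 × CVec t₁ × CVec t₂) × CVec r₂ × CVec r₃ =>
      G.out₃ ω.1.2.1 ω.1.2.2 ω.2.2 := by unfold out₃; fun_prop
  let e : (CVec t₂ × CVec 0) × CVec t₁ → CVec t₁ × CVec t₂ := fun p => (p.2, p.1.1)
  have he : Measurable e := by fun_prop
  have hg : Measurable fun p => G.recvSignal (e p) := by fun_prop
  have := isMarkovKernel_awgn hg
  have hV : Measurable fun x : CVec 0 × CVec t₁ × CVec t₂ => ((x.2.2, x.1), x.2.1) := by fun_prop
  have hfst : μ.map (fun ω => ((ω.1.2.2, ω.1.1), ω.1.2.1))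
      = (ν : Measure (CVec t₁ × CVec t₂)).map fun x => ((x.2, 0), x.1) := by
    rw [hμ, map_prod_fst _ _ hV, hν', Measure.map_map hV hm]
    rfl
  have hW : μ.map (fun ω => (((ω.1.2.2, ω.1.1), ω.1.2.1), G.out₃ ω.1.2.1 ω.1.2.2 ω.2.2))
      = μ.map (fun ω => ((ω.1.2.2, ω.1.1), ω.1.2.1)) ⊗ₘ awgn (fun p => G.recvSignal (e p)) := by
    rw [hμ, map_prod_fst _ _ hV, ← map_awgn_snd (r₂ := r₂) _ hV hg]
    rfl
  have hI := condMutualInfo_eq_lintegral (μ := μ) (by fun_prop) (by fun_prop) hY _ hW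
  let Q := condDistrib (fun ω => G.out₃ ω.1.2.1 ω.1.2.2 ω.2.2) (fun ω => (ω.1.2.2, ω.1.1)) μ
  have hz : Measurable fun y : CVec t₂ => (y, (0 : CVec 0)) := by fun_prop
  -- Inserting the only value of U turns the conditional law given (X₂, U) into one given X₂; the
  -- summand I(U;Y₂|X₂) is dropped.
  refine ⟨Q.comap _ hz, inferInstance,
    (G.min_multipleAccessInfo_le_pdfRate ν (f := fun _ => 0) measurable_const ν' hν'
    (le_trans (le_of_eq ?_) le_add_self)).trans
    (G.pdfRate_le_RPDF ν (f := fun _ => 0) measurable_const ν' hν' h₁ h₂)⟩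
  refine Eq.trans ?_ hI.symm
  have hm' : Measurable fun p : (CVec t₂ × CVec 0) × CVec t₁ =>
      klDiv (awgn (fun p => G.recvSignal (e p)) p) (Q p.1) :=
    measurable_klDiv_kernel (awgn (fun p => G.recvSignal (e p))) (Q.prodMkRight (CVec t₁))
  rw [hfst, lintegral_map hm' (by fun_prop)]
  simp_rw [awgn_comp_apply G.measurable_recvSignal he]
  rfl

end PartialDecodeForward

/-- This is min(a, b + c) ≤ min(a, b) + min(a, c) applied to each input law: if either minimum on
the right is `a` it suffices alone, otherwise the right side is b + c. -/
theorem RCS_le_two_mul_RPDF (P : ℝ≥0) : G.RCS P ≤ 2 * G.RPDF P := by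
  refine iSup_le fun ν => iSup_le fun h₁ => iSup_le fun h₂ => ?_
  obtain ⟨Q₂, _, hQ₂⟩ := G.exists_le_RPDF_of_relay ν h₁ h₂
  obtain ⟨Q₃, _, hQ₃⟩ := G.exists_le_RPDF_of_recv ν h₁ h₂
  have hB := G.broadcastInfo_le_add ν Q₂ Q₃
  rw [cutsetRate_eq, two_mul]
  refine le_trans ?_ (add_le_add hQ₂ hQ₃)
  rcases min_cases (G.multipleAccessInfo ν)
    ((∫⁻ x, klDiv (G.relayKernel x) (Q₂ x.2) ∂(ν : Measure (CVec t₁ × CVec t₂)))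
      / ENNReal.ofReal (Real.log 2)) with ⟨h, -⟩ | ⟨h, -⟩
  · rw [h]
    exact (min_le_left _ _).trans le_self_add
  rcases min_cases (G.multipleAccessInfo ν)
    ((∫⁻ x, klDiv (G.recvKernel x) (Q₃ x.2) ∂(ν : Measure (CVec t₁ × CVec t₂)))
      / ENNReal.ofReal (Real.log 2)) with ⟨h', -⟩ | ⟨h', -⟩
  · rw [h']
    exact (min_le_left _ _).trans le_add_self
  · rw [h, h']
    exact (min_le_right _ _).trans hB

end Channel

end MIMORelay

namespace MIMORelay

open InformationTheory

/-! ### Noise sequences and uniform messages. -/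

section PiMeasure

variable {E : Type*} [MeasurableSpace E] (N : Measure E) [IsProbabilityMeasure N]

lemma measurable_finSnoc {k : ℕ} :
    Measurable fun p : (Fin k → E) × E =>
      (Fin.snoc (α := fun _ => E) p.1 p.2 : Fin (k + 1) → E) := by
  refine measurable_pi_iff.2 fun i => ?_
  refine Fin.lastCases ?_ (fun j => ?_) i
  · simpa using measurable_snd
  · simp only [Fin.snoc_castSucc]
    fun_prop

lemma pi_succ_eq_map_snoc (k : ℕ) :
    Measure.pi (fun _ : Fin (k + 1) => N)
      = ((Measure.pi fun _ : Fin k => N).prod N).map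
        fun p => (Fin.snoc (α := fun _ => E) p.1 p.2 : Fin (k + 1) → E) := by
  have h := (measurePreserving_piFinSuccAbove (fun _ : Fin (k + 1) => N) (Fin.last k)).symm
  rw [← h.map_eq, ← Measure.prod_swap, Measure.map_map (MeasurableEquiv.measurable _)
    measurable_swap]
  congr 1
  ext p : 1
  exact Fin.insertNth_last' _ _

lemma pi_map_comp_injective {m n : ℕ} {e : Fin m → Fin n} (he : Function.Injective e) :
    (Measure.pi fun _ : Fin n => N).map (fun z i => z (e i)) = Measure.pi fun _ : Fin m => N := by
  have h : iIndepFun (fun i (z : Fin n → E) => z i) (Measure.pi fun _ : Fin n => N) :=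
    iIndepFun_pi (X := fun _ x => x) fun _ => aemeasurable_id
  have h' := (iIndepFun_iff_map_fun_eq_pi_map (fun i => (measurable_pi_apply (e i)).aemeasurable)).1
    (h.precomp he)
  rw [h']
  congr 1
  ext i : 1
  exact (measurePreserving_eval (fun _ : Fin n => N) (e i)).map_eq

end PiMeasure

section Uniform

variable {M : ℕ} [NeZero M]

instance : IsProbabilityMeasure (uniformOn (Set.univ : Set (Fin M))) :=
  isProbabilityMeasure_uniformOn Set.finite_univ Set.univ_nonempty

instance {r₂ r₃ n : ℕ} : IsProbabilityMeasure (Code.law r₂ r₃ M n) :=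
  inferInstanceAs (IsProbabilityMeasure ((uniformOn (Set.univ : Set (Fin M))).prod
    ((Measure.pi fun _ : Fin n => noise r₂).prod (Measure.pi fun _ : Fin n => noise r₃))))

omit [NeZero M] in
-- For each observation exactly one message agrees with the guess, so independence leaves success
-- probability 1/M.
lemma uniformOn_univ_prod_graph {α : Type*} [MeasurableSpace α] (ρ : Measure α)
    [IsProbabilityMeasure ρ] {f : α → Fin M} (hf : Measurable f) :
    (uniformOn (Set.univ : Set (Fin M))).prod ρ {p | f p.2 = p.1} = (M : ℝ≥0∞)⁻¹ := by
  have hms : MeasurableSet {p : Fin M × α | f p.2 = p.1} :=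
    measurableSet_eq_fun (by fun_prop) (by fun_prop)
  rw [Measure.prod_apply_symm hms]
  have : ∀ y, uniformOn (Set.univ : Set (Fin M)) ((fun m => (m, y)) ⁻¹' {p | f p.2 = p.1})
      = (M : ℝ≥0∞)⁻¹ := fun y => by
    have : (fun m => (m, y)) ⁻¹' {p : Fin M × α | f p.2 = p.1} = {f y} := by
      ext m; simp [eq_comm]
    rw [this, uniformOn_univ]
    simp
  simp_rw [this]
  simp

end Uniform

/-- The encoders of a relay code without an end of transmission. -/
structure Scheme (t₁ t₂ r₂ M : ℕ) where
  enc : Fin M → ℕ → CVec t₁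
  relay : (i : ℕ) → (Fin i → CVec r₂) → CVec t₂
  measurable_relay : ∀ i, Measurable (relay i)

open Code (Sample law)

variable {t₁ t₂ r₂ r₃ M : ℕ}

/-- Append one received symbol each to the received sequences. -/
def snocOutputs {k : ℕ} (p : Sample r₂ r₃ M k × CVec r₂ × CVec r₃) : Sample r₂ r₃ M (k + 1) :=
  (p.1.1, Fin.snoc (α := fun _ => CVec r₂) p.1.2.1 p.2.1,
    Fin.snoc (α := fun _ => CVec r₃) p.1.2.2 p.2.2)

lemma measurable_snocOutputs {k : ℕ} :
    Measurable (snocOutputs : Sample r₂ r₃ M k × CVec r₂ × CVec r₃ → _) := by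
  refine Measurable.prodMk (by fun_prop) (Measurable.prodMk ?_ ?_)
  · exact measurable_finSnoc.comp (f := fun p : Sample r₂ r₃ M k × CVec r₂ × CVec r₃ =>
      (p.1.2.1, p.2.1)) (by fun_prop)
  · exact measurable_finSnoc.comp (f := fun p : Sample r₂ r₃ M k × CVec r₂ × CVec r₃ =>
      (p.1.2.2, p.2.2)) (by fun_prop)

lemma law_succ [NeZero M] (k : ℕ) :
    law r₂ r₃ M (k + 1) = ((law r₂ r₃ M k).prod ((noise r₂).prod (noise r₃))).map snocOutputs := by
  rw [law, pi_succ_eq_map_snoc, pi_succ_eq_map_snoc,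
    Measure.map_prod_map _ _ measurable_finSnoc measurable_finSnoc]
  refine Measure.ext_of_lintegral _ fun f hf => ?_
  have hs := measurable_snocOutputs (r₂ := r₂) (r₃ := r₃) (M := M) (k := k)
  have hfs : Measurable fun p : Sample r₂ r₃ M k × CVec r₂ × CVec r₃ => f (snocOutputs p) :=
    hf.comp hs
  rw [lintegral_map hf hs, lintegral_prod _ hfs.aemeasurable, law,
    lintegral_prod _ hfs.lintegral_prod_right'.aemeasurable, lintegral_prod _ hf.aemeasurable]
  refine lintegral_congr fun m => ?_
  have h1 : Measurable fun q : (Fin k → CVec r₂) × (Fin k → CVec r₃) =>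
      ∫⁻ b, f (snocOutputs ((m, q), b)) ∂(noise r₂).prod (noise r₃) :=
    hfs.lintegral_prod_right'.comp measurable_prodMk_left
  have h2 : Measurable fun q : ((Fin k → CVec r₂) × CVec r₂) × (Fin k → CVec r₃) × CVec r₃ =>
      f (snocOutputs ((m, (q.1.1, q.2.1)), (q.1.2, q.2.2))) := hfs.comp (by fun_prop)
  rw [lintegral_prod _ h1.aemeasurable, lintegral_map (f := fun y => f (m, y)) (by fun_prop)
    (measurable_finSnoc.prodMap measurable_finSnoc)]
  refine (lintegral_prod _ h2.aemeasurable).trans ?_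
  rw [lintegral_prod _ h2.lintegral_prod_right'.aemeasurable]
  refine lintegral_congr fun z₂ => ?_
  have h3 : Measurable fun q : (CVec r₂ × (Fin k → CVec r₃)) × CVec r₃ =>
      f (snocOutputs ((m, (z₂, q.1.2)), (q.1.1, q.2))) := hfs.comp (by fun_prop)
  have h4 : ∀ a, ∫⁻ y : (Fin k → CVec r₃) × CVec r₃, f (snocOutputs ((m, (z₂, y.1)), (a, y.2)))
        ∂(Measure.pi fun _ : Fin k => noise r₃).prod (noise r₃)
      = ∫⁻ z₃, ∫⁻ b, f (snocOutputs ((m, (z₂, z₃)), (a, b))) ∂noise r₃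
        ∂(Measure.pi fun _ : Fin k => noise r₃) := fun a =>
    lintegral_prod _ (h3.comp (f := fun y : (Fin k → CVec r₃) × CVec r₃ => ((a, y.1), y.2))
      (by fun_prop)).aemeasurable
  have h5 : ∀ z₃, ∫⁻ b, f (snocOutputs ((m, (z₂, z₃)), b)) ∂(noise r₂).prod (noise r₃)
      = ∫⁻ a, ∫⁻ b, f (snocOutputs ((m, (z₂, z₃)), (a, b))) ∂noise r₃ ∂noise r₂ := fun z₃ =>
    lintegral_prod _ (h3.comp (f := fun b : CVec r₂ × CVec r₃ => ((b.1, z₃), b.2))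
      (by fun_prop)).aemeasurable
  simp_rw [h4, h5]
  -- The new relay noise and the old receiver noise are integrated in opposite orders on the two
  -- sides.
  exact lintegral_lintegral_swap h3.lintegral_prod_right'.aemeasurable

/-! ### True and alternative laws of a transmission, and the change of measure. -/

namespace Scheme

variable (S : Scheme t₁ t₂ r₂ M) (G : Channel t₁ t₂ r₂ r₃)

/-- The symbols transmitted at time `k`, in terms of the message and of what was received before. -/
def input (k : ℕ) (h : Sample r₂ r₃ M k) : CVec t₁ × CVec t₂ := (S.enc h.1 k, S.relay k h.2.1)

/-- The message and the received sequences, in terms of the message and the noise. -/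
def outputs (k : ℕ) (ω : Sample r₂ r₃ M k) : Sample r₂ r₃ M k :=
  (ω.1, fun j => G.out₂ (S.enc ω.1 j) (ω.2.1 j),
    fun j => G.out₃ (S.enc ω.1 j) (S.relay j fun i =>
      G.out₂ (S.enc ω.1 i) (ω.2.1 (Fin.castLE j.isLt.le i))) (ω.2.2 j))

@[fun_prop]
lemma measurable_enc (i : ℕ) : Measurable fun m => S.enc m i := measurable_of_finite _

@[fun_prop]
lemma measurable_relay_comp {α : Type*} [MeasurableSpace α] {i : ℕ} {f : α → Fin i → CVec r₂}
    (hf : Measurable f) : Measurable fun a => S.relay i (f a) :=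
  (S.measurable_relay i).comp hf

@[fun_prop]
lemma measurable_input (k : ℕ) : Measurable (S.input (r₃ := r₃) k) := by
  have h : Measurable fun h : Sample r₂ r₃ M k => S.enc h.1 k :=
    (S.measurable_enc k).comp measurable_fst
  unfold input
  fun_prop

@[fun_prop]
lemma measurable_outputs (k : ℕ) : Measurable (S.outputs G k) := by
  have h (i : ℕ) : Measurable fun h : Sample r₂ r₃ M k => S.enc h.1 i :=
    (S.measurable_enc i).comp measurable_fst
  refine Measurable.prodMk (by fun_prop) (Measurable.prodMk (measurable_pi_iff.2 fun j => ?_)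
    (measurable_pi_iff.2 fun j => ?_))
  · unfold Channel.out₂; fun_prop
  · unfold Channel.out₃ Channel.out₂; fun_prop

/-- Causality: the symbols sent at time k depend only on the message and earlier outputs, so fresh
noise affects only the new outputs. -/
lemma outputs_snocOutputs (k : ℕ) (ω : Sample r₂ r₃ M k) (z : CVec r₂ × CVec r₃) :
    S.outputs G (k + 1) (snocOutputs (ω, z)) = snocOutputs (S.outputs G k ω,
      G.relaySignal (S.input k (S.outputs G k ω)) + z.1,
      G.recvSignal (S.input k (S.outputs G k ω)) + z.2) := by
  have hcast (j : ℕ) (hj : j ≤ k) (h : j ≤ k + 1) (i : Fin j) :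
      Fin.castLE h i = Fin.castSucc (Fin.castLE hj i) := rfl
  refine Prod.ext rfl (Prod.ext ?_ ?_)
  · funext j
    refine Fin.lastCases ?_ (fun j => ?_) j
    · simp [outputs, snocOutputs, input, Channel.out₂, Channel.relaySignal]
    · simp [outputs, snocOutputs]
  · funext j
    refine Fin.lastCases ?_ (fun j => ?_) j
    · simp only [outputs, snocOutputs, Fin.snoc_last, Fin.val_last]
      simp only [hcast k le_rfl, Fin.snoc_castSucc]
      rfl
    · simp only [outputs, snocOutputs, Fin.snoc_castSucc, Fin.val_castSucc]
      congr 2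
      funext i
      rw [hcast j j.isLt.le, Fin.snoc_castSucc]

/-- The law of the message and the received sequences. -/
def outputLaw (k : ℕ) : Measure (Sample r₂ r₃ M k) := (law r₂ r₃ M k).map (S.outputs G k)

instance [NeZero M] (k : ℕ) : IsProbabilityMeasure (S.outputLaw G k) :=
  Measure.isProbabilityMeasure_map (S.measurable_outputs G k).aemeasurable

lemma outputLaw_zero : S.outputLaw G 0 = law r₂ r₃ M 0 := by
  have : S.outputs G 0 = id := by
    funext ω
    exact Prod.ext rfl (Subsingleton.elim _ _)
  rw [outputLaw, this, Measure.map_id]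

/-- The two outputs at time `k`, given what was received before. -/
abbrev stepKernel (k : ℕ) : Kernel (Sample r₂ r₃ M k) (CVec r₂ × CVec r₃) :=
  (G.relayKernel ×ₖ G.recvKernel).comap (S.input k) (S.measurable_input k)

lemma outputLaw_succ [NeZero M] (k : ℕ) :
    S.outputLaw G (k + 1) = (S.outputLaw G k ⊗ₘ S.stepKernel G k).map snocOutputs := by
  have hg₂ : Measurable fun h => G.relaySignal (S.input (r₃ := r₃) k h) := by fun_prop
  have hg₃ : Measurable fun h => G.recvSignal (S.input (r₃ := r₃) k h) := by fun_prop
  have hK : S.stepKernel G k = awgn (fun h => G.relaySignal (S.input k h))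
      ×ₖ awgn (fun h => G.recvSignal (S.input k h)) := by
    ext1 h
    rw [Kernel.comap_apply, awgn_prod_apply hg₂ hg₃, awgn_prod_apply (by fun_prop) (by fun_prop)]
  rw [hK, outputLaw, outputLaw, ← map_awgn_prod _ (S.measurable_outputs G k) hg₂ hg₃, law_succ,
    Measure.map_map (by fun_prop) measurable_snocOutputs,
    Measure.map_map measurable_snocOutputs (by fun_prop)]
  congr 1
  funext ω
  exact S.outputs_snocOutputs G k ω.1 ω.2

/-- The law of the message and the received sequences if the channel were `T`. -/
def altLaw (T : Kernel (CVec t₁ × CVec t₂) (CVec r₂ × CVec r₃)) :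
    (k : ℕ) → Measure (Sample r₂ r₃ M k)
  | 0 => law r₂ r₃ M 0
  | k + 1 => (altLaw T k ⊗ₘ T.comap (S.input k) (S.measurable_input k)).map snocOutputs

variable (T : Kernel (CVec t₁ × CVec t₂) (CVec r₂ × CVec r₃)) [IsMarkovKernel T]

instance isProbabilityMeasure_altLaw [NeZero M] (k : ℕ) :
    IsProbabilityMeasure (S.altLaw T k) := by
  induction k with
  | zero => exact inferInstanceAs (IsProbabilityMeasure (law r₂ r₃ M 0))
  | succ k ih => exact Measure.isProbabilityMeasure_map measurable_snocOutputs.aemeasurable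

/-- The law of the symbols transmitted at time `k`. -/
def inputLaw (k : ℕ) : Measure (CVec t₁ × CVec t₂) := (S.outputLaw G k).map (S.input k)

instance [NeZero M] (k : ℕ) : IsProbabilityMeasure (S.inputLaw G k) :=
  Measure.isProbabilityMeasure_map (S.measurable_input k).aemeasurable

/-- The divergence between the true and the alternative law is at most the sum of the single-letter
divergences. -/
theorem klDiv_outputLaw_altLaw_le [NeZero M] (n : ℕ) :
    klDiv (S.outputLaw G n) (S.altLaw T n)
      ≤ ∑ i ∈ Finset.range n, ∫⁻ x, klDiv ((G.relayKernel ×ₖ G.recvKernel) x) (T x)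
        ∂S.inputLaw G i := by
  induction n with
  | zero => simp [outputLaw_zero, altLaw]
  | succ k ih =>
    have := S.isProbabilityMeasure_altLaw T k
    rw [outputLaw_succ, altLaw, Finset.sum_range_succ]
    -- After data processing, the chain rule adds one conditional divergence. Both step kernels see
    -- the history only through the current input, so it is an average over the input law.
    refine (klDiv_map_le _ _ measurable_snocOutputs).trans ?_
    rw [klDiv_compProd_eq_add, klDiv_compProd_right, inputLaw,
      lintegral_map (measurable_klDiv_kernel _ _) (S.measurable_input k)]
    exact add_le_add ih le_rfl

/-- The fictitious channel ignores x₁, and x₂ is a function of past relay outputs, so the message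
never influences any output. -/
lemma altLaw_prodMkLeft [NeZero M] (Q : Kernel (CVec t₂) (CVec r₂ × CVec r₃)) [IsMarkovKernel Q]
    (k : ℕ) : ∃ ρ : Measure ((Fin k → CVec r₂) × (Fin k → CVec r₃)), IsProbabilityMeasure ρ ∧
      S.altLaw (Q.prodMkLeft (CVec t₁)) k = (uniformOn (Set.univ : Set (Fin M))).prod ρ := by
  induction k with
  | zero => exact ⟨_, inferInstance, rfl⟩
  | succ k ih =>
    obtain ⟨ρ, _, hρ⟩ := ih
    let g : ((Fin k → CVec r₂) × (Fin k → CVec r₃)) × CVec r₂ × CVec r₃ →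
        (Fin (k + 1) → CVec r₂) × (Fin (k + 1) → CVec r₃) := fun p =>
      (Fin.snoc (α := fun _ => CVec r₂) p.1.1 p.2.1, Fin.snoc (α := fun _ => CVec r₃) p.1.2 p.2.2)
    have hg : Measurable g := (measurable_finSnoc.comp
      (f := fun p : ((Fin k → CVec r₂) × (Fin k → CVec r₃)) × CVec r₂ × CVec r₃ =>
        (p.1.1, p.2.1)) (by fun_prop)).prodMk (measurable_finSnoc.comp
      (f := fun p : ((Fin k → CVec r₂) × (Fin k → CVec r₃)) × CVec r₂ × CVec r₃ =>
        (p.1.2, p.2.2)) (by fun_prop))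
    let Q' : Kernel ((Fin k → CVec r₂) × (Fin k → CVec r₃)) (CVec r₂ × CVec r₃) :=
      Q.comap (fun y => S.relay k y.1) (by fun_prop)
    refine ⟨(ρ ⊗ₘ Q').map g, Measure.isProbabilityMeasure_map hg.aemeasurable, ?_⟩
    rw [altLaw, hρ]
    refine Measure.ext_of_lintegral _ fun f hf => ?_
    have hfs : Measurable fun p : Sample r₂ r₃ M k × CVec r₂ × CVec r₃ => f (snocOutputs p) :=
      hf.comp measurable_snocOutputs
    rw [lintegral_map hf measurable_snocOutputs, Measure.lintegral_compProd hfs,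
      lintegral_prod _ hfs.lintegral_kernel_prod_right'.aemeasurable,
      lintegral_prod _ hf.aemeasurable]
    refine lintegral_congr fun m => ?_
    have hfg : Measurable fun p => f (m, g p) := by fun_prop
    rw [lintegral_map (f := fun y => f (m, y)) (by fun_prop) hg, Measure.lintegral_compProd hfg]
    rfl

/-- The receiver's symbols are drawn from `Q` whatever is sent. The relay's outputs may still reveal
the message, so independence is claimed only after they are discarded. -/
lemma altLaw_prod_const [NeZero M] (W : Kernel (CVec t₁ × CVec t₂) (CVec r₂)) [IsMarkovKernel W]
    (Q : Measure (CVec r₃)) [IsProbabilityMeasure Q] (k : ℕ) :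
    ∃ ρ : Measure (Fin k → CVec r₃), IsProbabilityMeasure ρ ∧
      (S.altLaw (W ×ₖ Kernel.const _ Q) k).map (fun h => (h.1, h.2.2))
        = (uniformOn (Set.univ : Set (Fin M))).prod ρ := by
  have hm (k : ℕ) : Measurable fun h : Sample r₂ r₃ M k => (h.1, h.2.2) := by fun_prop
  induction k with
  | zero =>
    refine ⟨Measure.pi fun _ => noise r₃, inferInstance, ?_⟩
    rw [altLaw, law]
    conv_lhs => rw [show (fun h : Sample r₂ r₃ M 0 => (h.1, h.2.2)) = Prod.map id Prod.snd from rfl,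
      ← Measure.map_prod_map _ _ measurable_id measurable_snd]
    rw [Measure.map_id, ← Measure.snd, Measure.snd_prod]
  | succ k ih =>
    obtain ⟨ρ, _, hρ⟩ := ih
    have := S.isProbabilityMeasure_altLaw (W ×ₖ Kernel.const _ Q) k
    refine ⟨(ρ.prod Q).map fun p => Fin.snoc (α := fun _ => CVec r₃) p.1 p.2,
      Measure.isProbabilityMeasure_map measurable_finSnoc.aemeasurable, ?_⟩
    rw [altLaw, Measure.map_map (hm _) measurable_snocOutputs]
    refine Measure.ext_of_lintegral _ fun f hf => ?_
    have hfs : Measurable fun p : (Fin M × (Fin k → CVec r₃)) × CVec r₃ =>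
        f (p.1.1, Fin.snoc (α := fun _ => CVec r₃) p.1.2 p.2) :=
      hf.comp (Measurable.prodMk (by fun_prop) (measurable_finSnoc.comp
        (f := fun p : (Fin M × (Fin k → CVec r₃)) × CVec r₃ => (p.1.2, p.2)) (by fun_prop)))
    have hF : Measurable fun h : Fin M × (Fin k → CVec r₃) =>
        ∫⁻ b, f (h.1, Fin.snoc (α := fun _ => CVec r₃) h.2 b) ∂Q := hfs.lintegral_prod_right'
    have h1 : ∫⁻ p, f ((fun h : Sample r₂ r₃ M (k + 1) => (h.1, h.2.2)) (snocOutputs p))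
        ∂(S.altLaw (W ×ₖ Kernel.const _ Q) k
          ⊗ₘ (W ×ₖ Kernel.const _ Q).comap (S.input k) (S.measurable_input k))
        = ∫⁻ h, ∫⁻ b, f (h.1, Fin.snoc (α := fun _ => CVec r₃) h.2 b) ∂Q
          ∂(S.altLaw (W ×ₖ Kernel.const _ Q) k).map (fun h => (h.1, h.2.2)) := by
      have hfs' : Measurable fun p : Sample r₂ r₃ M k × CVec r₂ × CVec r₃ =>
          f ((snocOutputs p).1, (snocOutputs p).2.2) :=
        hf.comp ((hm _).comp measurable_snocOutputs)
      rw [lintegral_map hF (hm k)]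
      refine (Measure.lintegral_compProd hfs').trans ?_
      refine lintegral_congr fun h => ?_
      have hb : Measurable fun b : CVec r₂ × CVec r₃ =>
          f (h.1, Fin.snoc (α := fun _ => CVec r₃) h.2.2 b.2) :=
        hfs.comp (f := fun b : CVec r₂ × CVec r₃ => ((h.1, h.2.2), b.2)) (by fun_prop)
      rw [Kernel.comap_apply, Kernel.prod_apply, Kernel.const_apply]
      refine (lintegral_prod _ hb.aemeasurable).trans ?_
      simp
    rw [lintegral_map hf ((hm _).comp measurable_snocOutputs)]
    refine h1.trans ?_
    rw [hρ, lintegral_prod _ hF.aemeasurable, lintegral_prod _ hf.aemeasurable]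
    refine lintegral_congr fun m => ?_
    rw [lintegral_map (f := fun y => f (m, y)) (by fun_prop) measurable_finSnoc]
    exact (lintegral_prod _ (hfs.comp (f := fun p : (Fin k → CVec r₃) × CVec r₃ =>
      ((m, p.1), p.2)) (by fun_prop)).aemeasurable).symm

/-- If the message and the receiver's observations are independent under the alternative law, the
probability of a correct decision is limited by the single-letter divergences. -/
theorem measureReal_correct_mul_log_le [NeZero M] {n : ℕ} {dec : (Fin n → CVec r₃) → Fin M}
    (hdec : Measurable dec) {ρ : Measure (Fin n → CVec r₃)} [IsProbabilityMeasure ρ]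
    (hρ : (S.altLaw T n).map (fun h => (h.1, h.2.2))
      = (uniformOn (Set.univ : Set (Fin M))).prod ρ) :
    ENNReal.ofReal ((S.outputLaw G n).real {h | dec h.2.2 = h.1} * Real.log M)
      ≤ ∑ i ∈ Finset.range n, ∫⁻ x, klDiv ((G.relayKernel ×ₖ G.recvKernel) x) (T x)
        ∂S.inputLaw G i + ENNReal.ofReal (Real.log 2) := by
  have hA : MeasurableSet {h : Sample r₂ r₃ M n | dec h.2.2 = h.1} :=
    measurableSet_eq_fun (by fun_prop) (by fun_prop)
  have hA' : MeasurableSet {p : Fin M × (Fin n → CVec r₃) | dec p.2 = p.1} :=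
    measurableSet_eq_fun (by fun_prop) (by fun_prop)
  have hm : Measurable fun h : Sample r₂ r₃ M n => (h.1, h.2.2) := by fun_prop
  have := S.isProbabilityMeasure_altLaw T n
  have hν : (S.altLaw T n).real {h | dec h.2.2 = h.1} = (M : ℝ)⁻¹ := by
    have h := uniformOn_univ_prod_graph (M := M) ρ hdec
    rw [← hρ, Measure.map_apply hm hA'] at h
    rw [measureReal_def]
    refine (congrArg ENNReal.toReal h).trans ?_
    simp
  refine (mul_log_le_klDiv_add_log_two (S.outputLaw G n) (S.altLaw T n) hA
    (by exact_mod_cast NeZero.one_le) hν).trans ?_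
  gcongr
  exact S.klDiv_outputLaw_altLaw_le G T n

end Scheme

end MIMORelay

/-! ### The converse: from single codes to capacity. -/

namespace MIMORelay

open InformationTheory

open Code (Sample law)

variable {t₁ t₂ r₂ r₃ M n : ℕ}

/-- Symbols sent at time i involve only a prefix of the noise; this passes from block length n to i.
-/
lemma law_map_castLE [NeZero M] {i : ℕ} (h : i ≤ n) :
    (law r₂ r₃ M n).map (fun ω => (ω.1, fun j => ω.2.1 (Fin.castLE h j),
      fun j => ω.2.2 (Fin.castLE h j))) = law r₂ r₃ M i := by
  have hm₂ : Measurable fun (z : Fin n → CVec r₂) (j : Fin i) => z (Fin.castLE h j) := by fun_prop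
  have hm₃ : Measurable fun (z : Fin n → CVec r₃) (j : Fin i) => z (Fin.castLE h j) := by fun_prop
  have hinj := Fin.castLE_injective h
  rw [law, law, ← pi_map_comp_injective (noise r₂) hinj, ← pi_map_comp_injective (noise r₃) hinj,
    Measure.map_prod_map _ _ hm₂ hm₃]
  conv_rhs => rw [← Measure.map_id (μ := uniformOn (Set.univ : Set (Fin M))),
    Measure.map_prod_map _ _ measurable_id (hm₂.prodMap hm₃)]
  rfl

namespace Code

variable (c : Code t₁ t₂ r₂ r₃ M n) (G : Channel t₁ t₂ r₂ r₃)

/-- Send zeros after the end of the transmission. -/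
def toScheme : Scheme t₁ t₂ r₂ M where
  enc m i := if h : i < n then c.enc m ⟨i, h⟩ else 0
  relay i y := if h : i < n then c.relay ⟨i, h⟩ y else 0
  measurable_relay i := by
    by_cases h : i < n
    · simpa [h] using c.measurable_relay ⟨i, h⟩
    · simp [h]

lemma outputs_toScheme (ω : Sample r₂ r₃ M n) :
    c.toScheme.outputs G n ω = (ω.1, fun j => c.y₂ G j ω, fun j => c.y₃ G j ω) := by
  have henc (m : Fin M) (j : ℕ) (hj : j < n) : c.toScheme.enc m j = c.enc m ⟨j, hj⟩ := dif_pos hj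
  have hrel (j : ℕ) (hj : j < n) (y) : c.toScheme.relay j y = c.relay ⟨j, hj⟩ y := dif_pos hj
  refine Prod.ext rfl (Prod.ext ?_ ?_)
  · funext j
    simp only [Scheme.outputs, henc _ _ j.isLt]
    rfl
  · funext j
    simp only [Scheme.outputs, henc _ _ j.isLt, hrel _ j.isLt,
      fun i : Fin j => henc ω.1 i (i.isLt.trans j.isLt)]
    rfl

lemma inputLaw_toScheme [NeZero M] {i : ℕ} (h : i < n) :
    c.toScheme.inputLaw G i
      = (law r₂ r₃ M n).map fun ω => (c.x₁ ⟨i, h⟩ ω, c.x₂ G ⟨i, h⟩ ω) := by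
  have henc (m : Fin M) (j : ℕ) (hj : j < n) : c.toScheme.enc m j = c.enc m ⟨j, hj⟩ := dif_pos hj
  have hrel (j : ℕ) (hj : j < n) (y) : c.toScheme.relay j y = c.relay ⟨j, hj⟩ y := dif_pos hj
  rw [Scheme.inputLaw, Scheme.outputLaw, ← law_map_castLE h.le,
    Measure.map_map (by fun_prop) (by fun_prop), Measure.map_map (by fun_prop) (by fun_prop)]
  congr 1
  funext ω
  simp only [Function.comp, Scheme.input, Scheme.outputs, henc _ _ h, hrel _ h,
    fun j : Fin i => henc ω.1 j (j.isLt.trans h)]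
  rfl

/-- The law of the transmitted symbols at a uniformly chosen time. -/
def averageInputLaw : Measure (CVec t₁ × CVec t₂) :=
  (n : ℝ≥0∞)⁻¹ • ∑ i ∈ Finset.range n, c.toScheme.inputLaw G i

lemma lintegral_averageInputLaw (f : CVec t₁ × CVec t₂ → ℝ≥0∞) :
    ∫⁻ x, f x ∂c.averageInputLaw G
      = (n : ℝ≥0∞)⁻¹ * ∑ i ∈ Finset.range n, ∫⁻ x, f x ∂c.toScheme.inputLaw G i := by
  rw [averageInputLaw, lintegral_smul_measure, lintegral_finsetSum_measure, smul_eq_mul]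

lemma mul_lintegral_averageInputLaw (hn : n ≠ 0) (f : CVec t₁ × CVec t₂ → ℝ≥0∞) :
    n * ∫⁻ x, f x ∂c.averageInputLaw G
      = ∑ i ∈ Finset.range n, ∫⁻ x, f x ∂c.toScheme.inputLaw G i := by
  rw [lintegral_averageInputLaw, ← mul_assoc, ENNReal.mul_inv_cancel (by exact_mod_cast hn)
    (ENNReal.natCast_ne_top n), one_mul]

lemma isProbabilityMeasure_averageInputLaw [NeZero M] (hn : n ≠ 0) :
    IsProbabilityMeasure (c.averageInputLaw G) := by
  constructor
  rw [← lintegral_one, lintegral_averageInputLaw]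
  simp [ENNReal.inv_mul_cancel (Nat.cast_ne_zero.2 hn) (ENNReal.natCast_ne_top n)]

lemma lintegral_averageInputLaw_le [NeZero M] (hn : n ≠ 0) {P : ℝ≥0}
    {f : CVec t₁ × CVec t₂ → ℝ≥0∞} (hf : Measurable f)
    (h : ∑ i, ∫⁻ ω, f (c.x₁ i ω, c.x₂ G i ω) ∂law r₂ r₃ M n ≤ n * P) :
    ∫⁻ x, f x ∂c.averageInputLaw G ≤ P := by
  have hmeas (i : Fin n) : Measurable fun ω => (c.x₁ i ω, c.x₂ G i ω) := by
    refine Measurable.prodMk ((measurable_of_finite fun m => c.enc m i).comp measurable_fst)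
      ((c.measurable_relay i).comp (measurable_pi_iff.2 fun j => ?_))
    have : Measurable fun ω : Sample r₂ r₃ M n => c.enc ω.1 (Fin.castLE i.isLt.le j) :=
      (measurable_of_finite fun m => c.enc m (Fin.castLE i.isLt.le j)).comp measurable_fst
    unfold y₂ Channel.out₂ x₁
    fun_prop
  have hsum : ∑ i ∈ Finset.range n, ∫⁻ x, f x ∂c.toScheme.inputLaw G i
      = ∑ i, ∫⁻ ω, f (c.x₁ i ω, c.x₂ G i ω) ∂law r₂ r₃ M n := by
    rw [← Fin.sum_univ_eq_sum_range]
    refine Finset.sum_congr rfl fun i _ => ?_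
    rw [inputLaw_toScheme c G i.isLt, lintegral_map hf (hmeas i)]
  rw [lintegral_averageInputLaw, hsum]
  refine (mul_le_mul_right h _).trans_eq ?_
  rw [← mul_assoc, ENNReal.inv_mul_cancel (by exact_mod_cast hn) (ENNReal.natCast_ne_top n),
    one_mul]

lemma measureReal_correct [NeZero M] :
    (c.toScheme.outputLaw G n).real {h | c.dec h.2.2 = h.1} = 1 - (c.errorProb G).toReal := by
  have hdec := c.measurable_dec
  have hA : MeasurableSet {h : Sample r₂ r₃ M n | c.dec h.2.2 = h.1} :=
    measurableSet_eq_fun (by fun_prop) (by fun_prop)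
  have he : c.errorProb G = c.toScheme.outputLaw G n {h | c.dec h.2.2 = h.1}ᶜ := by
    rw [Scheme.outputLaw, Measure.map_apply (by fun_prop) hA.compl, errorProb]
    congr 1
    ext ω
    simp [outputs_toScheme]
  rw [he, ← measureReal_def, probReal_compl_eq_one_sub hA, sub_sub_cancel]

/-- Converse to the coding theorem for a single code, with the mutual informations of the average
input distribution. -/
theorem mul_log_le_mul_cutsetRate [NeZero M] (hn : n ≠ 0)
    (ν : ProbabilityMeasure (CVec t₁ × CVec t₂))
    (hν : (ν : Measure (CVec t₁ × CVec t₂)) = c.averageInputLaw G) :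
    ENNReal.ofReal ((1 - (c.errorProb G).toReal) * Real.log M)
      ≤ n * (G.cutsetRate ν * ENNReal.ofReal (Real.log 2)) + ENNReal.ofReal (Real.log 2) := by
  have hlog0 : ENNReal.ofReal (Real.log 2) ≠ 0 := by simp [Real.log_pos one_lt_two]
  have hdiv (a : ℝ≥0∞) : a / ENNReal.ofReal (Real.log 2) * ENNReal.ofReal (Real.log 2) = a :=
    ENNReal.div_mul_cancel hlog0 ENNReal.ofReal_ne_top
  have hmac : ENNReal.ofReal ((1 - (c.errorProb G).toReal) * Real.log M)
      ≤ n * (G.multipleAccessInfo ν * ENNReal.ofReal (Real.log 2))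
        + ENNReal.ofReal (Real.log 2) := by
    -- `Q` is the receiver's output law for the time-averaged input. The fictitious channel keeps
    -- the true relay kernel, whose divergence from itself vanishes. Averaging is linear for fixed
    -- `Q`, so no concavity of mutual information is needed.
    obtain ⟨Q, _, hQ⟩ := G.exists_multipleAccessInfo_eq (ν : Measure (CVec t₁ × CVec t₂))
    obtain ⟨ρ, _, hρ⟩ := c.toScheme.altLaw_prod_const (r₃ := r₃) G.relayKernel Q n
    have h := c.toScheme.measureReal_correct_mul_log_le G (G.relayKernel ×ₖ Kernel.const _ Q)
      c.measurable_dec hρ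
    rw [← mul_lintegral_averageInputLaw c G hn, measureReal_correct] at h
    rw [hQ, hdiv, hν]
    refine h.trans_eq ?_
    congr 3
    funext x
    rw [Kernel.prod_apply, Kernel.prod_apply, klDiv_prod, klDiv_self, zero_add]
    rfl
  have hbc : ENNReal.ofReal ((1 - (c.errorProb G).toReal) * Real.log M)
      ≤ n * (G.broadcastInfo ν * ENNReal.ofReal (Real.log 2))
        + ENNReal.ofReal (Real.log 2) := by
    -- Here the fictitious channel generates both outputs from x₂ alone, by their conditional law
    -- given X₂ under the averaged input.
    obtain ⟨Q, _, hQ⟩ := G.exists_broadcastInfo_eq (ν : Measure (CVec t₁ × CVec t₂))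
    obtain ⟨ρ, _, hρ⟩ := c.toScheme.altLaw_prodMkLeft Q n
    have hρ' : (c.toScheme.altLaw (Q.prodMkLeft (CVec t₁)) n).map (fun h => (h.1, h.2.2))
        = (uniformOn (Set.univ : Set (Fin M))).prod ρ.snd := by
      rw [hρ, Measure.snd]
      conv_rhs => rw [← Measure.map_id (μ := uniformOn (Set.univ : Set (Fin M))),
        Measure.map_prod_map _ _ measurable_id measurable_snd]
      rfl
    have h := c.toScheme.measureReal_correct_mul_log_le G (Q.prodMkLeft (CVec t₁))
      c.measurable_dec hρ'
    rw [← mul_lintegral_averageInputLaw c G hn, measureReal_correct] at h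
    rw [hQ, hdiv, hν]
    exact h
  rw [Channel.cutsetRate_eq]
  rcases min_choice (G.multipleAccessInfo ν) (G.broadcastInfo ν) with h | h <;> rw [h]
  exacts [hmac, hbc]

theorem mul_log_le_mul_RCS [NeZero M] (hn : n ≠ 0) {P : ℝ≥0} (hc : c.PowerConstraint G P) :
    (1 - (c.errorProb G).toReal) * Real.log M
      ≤ n * ((G.RCS P).toReal * Real.log 2) + Real.log 2 := by
  have hprob := c.isProbabilityMeasure_averageInputLaw G hn
  let ν : ProbabilityMeasure (CVec t₁ × CVec t₂) := ⟨c.averageInputLaw G, hprob⟩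
  have h₁ : ∫⁻ x, energy x.1 ∂(ν : Measure (CVec t₁ × CVec t₂)) ≤ P :=
    c.lintegral_averageInputLaw_le G hn (f := fun x => energy x.1) (by fun_prop) hc.1
  have h₂ : ∫⁻ x, energy x.2 ∂(ν : Measure (CVec t₁ × CVec t₂)) ≤ P :=
    c.lintegral_averageInputLaw_le G hn (f := fun x => energy x.2) (by fun_prop) hc.2
  have hle : G.cutsetRate ν ≤ G.RCS P := le_iSup₂_of_le ν h₁ (le_iSup_of_le h₂ le_rfl)
  have h := (c.mul_log_le_mul_cutsetRate G hn ν rfl).trans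
    (add_le_add_left (mul_le_mul_right (mul_le_mul_left hle _) _) _)
  have hlog : 0 ≤ Real.log 2 := Real.log_nonneg one_le_two
  rw [← ENNReal.ofReal_toReal (G.RCS_ne_top P), ← ENNReal.ofReal_mul ENNReal.toReal_nonneg,
    ← ENNReal.ofReal_natCast, ← ENNReal.ofReal_mul (by positivity),
    ← ENNReal.ofReal_add (by positivity) hlog,
    ENNReal.ofReal_le_ofReal_iff (by positivity)] at h
  exact h

end Code

/-- The cutset bound. -/
theorem Channel.capacity_le_RCS (G : Channel t₁ t₂ r₂ r₃) (P : ℝ≥0) :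
    G.capacity P ≤ G.RCS P := by
  refine iSup_le fun R => iSup_le fun ⟨c, hc, herr⟩ => ?_
  have hlog : 0 < Real.log 2 := Real.log_pos one_lt_two
  -- The single-code bound divided by n log 2: the additive log 2 becomes 1/n, and rounding the
  -- number of messages up only helps.
  have hbound : ∀ n : ℕ, n ≠ 0 →
      (1 - ((c n).errorProb G).toReal) * R ≤ (G.RCS P).toReal + (n : ℝ)⁻¹ := by
    intro n hn
    have hn' : (0 : ℝ) < n := by exact_mod_cast Nat.pos_of_ne_zero hn
    have hpow : (0 : ℝ) < (2 : ℝ) ^ ((n : ℝ) * (R : ℝ)) := Real.rpow_pos_of_pos two_pos _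
    have : NeZero ⌈(2 : ℝ) ^ ((n : ℝ) * (R : ℝ))⌉₊ := ⟨(Nat.ceil_pos.2 hpow).ne'⟩
    have h := (c n).mul_log_le_mul_RCS G hn (hc n)
    have hM : (n : ℝ) * R * Real.log 2 ≤ Real.log ⌈(2 : ℝ) ^ ((n : ℝ) * (R : ℝ))⌉₊ := by
      rw [← Real.log_rpow two_pos]
      exact Real.log_le_log hpow (Nat.le_ceil _)
    have hcorr : 0 ≤ 1 - ((c n).errorProb G).toReal := by
      rw [← (c n).measureReal_correct G]; exact measureReal_nonneg
    have h' := (mul_le_mul_of_nonneg_left hM hcorr).trans h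
    have hpos : 0 < (n : ℝ) * Real.log 2 := mul_pos hn' hlog
    rw [← mul_le_mul_iff_left₀ hpos]
    have hinv : (n : ℝ)⁻¹ * n = 1 := inv_mul_cancel₀ hn'.ne'
    calc _ = (1 - ((c n).errorProb G).toReal) * (n * R * Real.log 2) := by ring
      _ ≤ _ := h'
      _ = n * ((G.RCS P).toReal * Real.log 2) + ((n : ℝ)⁻¹ * n) * Real.log 2 := by
        rw [hinv, one_mul]
      _ = _ := by ring
  have hlim : Filter.Tendsto (fun n => (1 - ((c n).errorProb G).toReal) * (R : ℝ)) Filter.atTop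
      (nhds R) := by
    have h := (ENNReal.tendsto_toReal ENNReal.zero_ne_top).comp herr
    simpa using (h.const_sub 1).mul_const (R : ℝ)
  have hlim' : Filter.Tendsto (fun n : ℕ => (G.RCS P).toReal + (n : ℝ)⁻¹) Filter.atTop
      (nhds (G.RCS P).toReal) := by
    simpa using (tendsto_inv_atTop_nhds_zero_nat (𝕜 := ℝ)).const_add (G.RCS P).toReal
  have hR : (R : ℝ) ≤ (G.RCS P).toReal := le_of_tendsto_of_tendsto hlim hlim' <| by
    filter_upwards [Filter.eventually_ne_atTop 0] with n hn using hbound n hn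
  rw [← ENNReal.ofReal_toReal (G.RCS_ne_top P), ← ENNReal.ofReal_coe_nnreal]
  exact ENNReal.ofReal_le_ofReal hR

end MIMORelay

end

theorem theorem2 (t₁ t₂ r₂ r₃ : ℕ) (G : MIMORelay.Channel t₁ t₂ r₂ r₃) (P : ℝ≥0) :
    G.RCS P ≠ ∞ ∧ G.RPDF P ≠ ∞ ∧
      G.RCS P ≤ 2 * G.RPDF P ∧
      G.capacity P ≤ 2 * G.RPDF P :=
  ⟨G.RCS_ne_top P, G.RPDF_ne_top P, G.RCS_le_two_mul_RPDF P,
    (G.capacity_le_RCS P).trans (G.RCS_le_two_mul_RPDF P)⟩
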